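/- Let $k$ be a field of characteristic $0$ with algebraic closure $\overline k$, let $t\ge 0$ and $t<\ell\le t+r$, and put $\mathbb K=k(X_1,\dots,X_t)$. Let $V\subset\overline k^{\,t+r}$ be a non-empty variety definable over $k$, equidimensional of dimension $t$, with $I(W)\cap k[X_1,\dots,X_t]=\{0\}$ for each irreducible component $W$ of $V$. Write $k[V]=k[X_1,\dots,X_{t+r}]/I(V)$ and $\mathbb K\otimes k[V]$ for the tensor product over $k[X_1,\dots,X_t]$. A linear form $\lambda\in k[X_{t+1},\dots,X_{t+r}]$ is a primitive element of $\mathbb K\otimes k[V]$ if it generates this $\mathbb K$-algebra. The geometric resolution of $V$ with free variables $X_1,\dots,X_t$ associated with such a $\lambda$ is the family $(q_\lambda,w_{t+1},\dots,w_{t+r})$ in $\mathbb K[Y]$, where $q_\lambda$ is the minimal polynomial of $\lambda$ over $\mathbb K$, $\deg w_j<\deg q_\lambda$, and $X_j=w_j(\lambda)$ in $\mathbb K\otimes k[V]$. Let $D=\dim_{\mathbb K}(\mathbb K\otimes k[V])=\deg q_\lambda$. Let $\pi:\overline k^{\,t+r}\to\overline k^{\,\ell}$ be the projection to the first $\ell$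 coordinates, and let $\mu=\sum_{j=t+1}^{\ell}\mu_jX_j$, $\mu_j\in k$, be a primitive element of $\mathbb K\otimes k[\overline{\pi(V)}]$. Algorithm GeomResProj, applied to a geometric resolution $(q_\lambda,w_{t+1},\dots,w_{t+r})$ of $V$ and to $\mu$, does the following. 1. Put $p_{\mu^0}=1$ and $p_\mu=\sum_{j=t+1}^{\ell}\mu_jw_j$. 2. For $i=2,\dots,D$ compute $p_{\mu^i}=(p_\mu\, p_{\mu^{i-1}} \bmod q_\lambda)$. 3. Compute the rank $\delta$ of the $D\times D$ matrix whose columns are the coefficient vectors $\mathbf p_{\mu^i}$ of $p_{\mu^0},\dots,p_{\mu^{D-1}}$; this step is done at a random point $x\in k^t$. 4. Let $\mathbf P=(\mathbf p_{\mu^0},\dots,\mathbf p_{\mu^{\delta-1}})\in\mathbb K^{D\times\delta}$. 5. With $\mathbf w_j$ the coefficient vector of $w_j$, solve $\mathbf P\mathbf q=\mathbf p_{\mu^\delta}$ and $\mathbf P\mathbf v_j=\mathbf w_j$ for $t+1\le j\le\ell$. 6. Return $q_\mu=Y^\delta-\sum_{i<\delta}q_iY^i$ and $v_j=\sum_{i<\delta}v_{j,i}Y^i$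 for $t+1\le j\le \ell$. **Claim.** The closure $\overline{\pi(V)}\subset\overline k^{\,\ell}$ is again a non-empty variety definable over $k$, equidimensional of dimension $t$, each of whose irreducible components $Z$ satisfies $I(Z)\cap k[X_1,\dots,X_t]=\{0\}$. The linear systems of step 5 have exactly one solution, and the output $(q_\mu,v_{t+1},\dots,v_\ell)$ is the geometric resolution of $\overline{\pi(V)}$ with free variables $X_1,\dots,X_t$ associated with $\mu$. Moreover, let $\Omega\ge 3$ be a real number (in particular, it may be an exponent $\Omega\ge3$ such that determinants and adjoints of $d\times d$ matrices over commutative rings are computed with $O(d^\Omega)$ operations). Suppose that the coefficients of $q_\lambda,w_{t+1},\dots,w_{t+r}$, as elements of $\mathbb K$, are given by a straight-line program (slp; operations $+,-,\times,/$) of length $L$ over $k$. Then the algorithm can be carried out, by an algebraic computation tree over $k$ that depends only on $t,r,\ell,D$ and on the shape of the input slp (not on $k$ nor on the scalars of the input), with at most $$C\,\bigl(L+D^\Omega+D^2(\ell-t)\bigr)$$ operations and comparisons in $k$. There is a non-zero polynomial $H\in k[X_1,\dots,X_t]$ such that, for every random point $x\in k^t$ with $H(x)\ne0$, it finds $\delta$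 and produces an slp over $k$, whose length satisfies the same bound, for the coefficients of the $p_{\mu^i}$ ($0\le i\le D$) and of $q_\mu,v_{t+1},\dots,v_\ell$. The constant $C$ depends at most on $\Omega$. -/

import Mathlib

open scoped TensorProduct

noncomputable section

/-! ## Affine varieties over an algebraic closure

Coordinates of the ambient space are indexed by `Fin t ⊕ Fin r`: `Sum.inl i` stands for the
variable `X_{i+1}` (`i < t`) and `Sum.inr j` for the variable `X_{t+j+1}` (`j < r`). -/

/-- Zariski closure of a subset of an affine space over a field `F`. -/
def zariskiClosure {F σ : Type*} [Field F] (S : Set (σ → F)) : Set (σ → F) :=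
  MvPolynomial.zeroLocus F (MvPolynomial.vanishingIdeal F S)

/-- Zariski closed subsets. -/
def IsZariskiClosed {F σ : Type*} [Field F] (S : Set (σ → F)) : Prop :=
  zariskiClosure S = S

/-- Irreducible Zariski closed subsets (the empty set is not irreducible). -/
def IsIrredClosed {F σ : Type*} [Field F] (W : Set (σ → F)) : Prop :=
  IsZariskiClosed W ∧ W.Nonempty ∧
    ∀ W₁ W₂ : Set (σ → F), IsZariskiClosed W₁ → IsZariskiClosed W₂ → W ⊆ W₁ ∪ W₂ →
      W ⊆ W₁ ∨ W ⊆ W₂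

/-- `W` is an irreducible component of `V`. -/
def IsComponent {F σ : Type*} [Field F] (W V : Set (σ → F)) : Prop :=
  Maximal (fun U : Set (σ → F) => IsIrredClosed U ∧ U ⊆ V) W

/-- Dimension of an irreducible closed set: transcendence degree of its coordinate ring. -/
def varDim {F σ : Type*} [Field F] (W : Set (σ → F)) : Cardinal :=
  Algebra.trdeg F (MvPolynomial σ F ⧸ MvPolynomial.vanishingIdeal F W)

/-- `V ⊆ k̄^{t+r}` is a (nonempty) variety definable over `k`, equidimensional of dimension `t`,
such that `I(W) ∩ k[X₁, …, X_t] = 0` for every irreducible component `W` of `V`. -/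
structure IsFreeEquidim (k : Type*) [Field k] {t r : ℕ}
    (V : Set (Fin t ⊕ Fin r → AlgebraicClosure k)) : Prop where
  definable : ∃ I : Ideal (MvPolynomial (Fin t ⊕ Fin r) k),
    V = MvPolynomial.zeroLocus (AlgebraicClosure k) I
  nonempty : V.Nonempty
  equidim : ∀ W, IsComponent W V → varDim W = (t : Cardinal)
  free : ∀ W, IsComponent W V → ∀ f : MvPolynomial (Fin t) k,
    MvPolynomial.rename Sum.inl f ∈
      (MvPolynomial.vanishingIdeal k W : Ideal (MvPolynomial (Fin t ⊕ Fin r) k)) → f = 0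

/-- The closure of the image of `V` under the projection `π : k̄^{t+r} → k̄^{t+s}` onto the first
`ℓ = t + s` coordinates. -/
def projClosure {F : Type*} [Field F] {t r s : ℕ} (hsr : s ≤ r) (V : Set (Fin t ⊕ Fin r → F)) :
    Set (Fin t ⊕ Fin s → F) :=
  zariskiClosure ((fun x => x ∘ Sum.map id (Fin.castLE hsr)) '' V)

/-! ## Geometric resolutions -/

/-- The field `𝕂 = k(X₁, …, X_t)`. -/
abbrev RatField (k : Type*) [Field k] (t : ℕ) : Type _ :=
  FractionRing (MvPolynomial (Fin t) k)

/-- The coordinate ring `k[V]`. -/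
def CoordRing (k : Type*) [Field k] {t r : ℕ}
    (V : Set (Fin t ⊕ Fin r → AlgebraicClosure k)) : Type _ :=
  MvPolynomial (Fin t ⊕ Fin r) k ⧸
    (MvPolynomial.vanishingIdeal k V : Ideal (MvPolynomial (Fin t ⊕ Fin r) k))

instance (k : Type*) [Field k] {t r : ℕ} (V : Set (Fin t ⊕ Fin r → AlgebraicClosure k)) :
    CommRing (CoordRing k V) :=
  inferInstanceAs (CommRing (MvPolynomial (Fin t ⊕ Fin r) k ⧸
    (MvPolynomial.vanishingIdeal k V : Ideal (MvPolynomial (Fin t ⊕ Fin r) k))))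

/-- The class of a polynomial in `k[V]`. -/
def CoordRing.mk (k : Type*) [Field k] {t r : ℕ}
    (V : Set (Fin t ⊕ Fin r → AlgebraicClosure k)) :
    MvPolynomial (Fin t ⊕ Fin r) k →+* CoordRing k V :=
  Ideal.Quotient.mk (MvPolynomial.vanishingIdeal k V : Ideal (MvPolynomial (Fin t ⊕ Fin r) k))

/-- `k[V]` as an algebra over `k[X₁, …, X_t]`. -/
instance (k : Type*) [Field k] {t r : ℕ} (V : Set (Fin t ⊕ Fin r → AlgebraicClosure k)) :
    Algebra (MvPolynomial (Fin t) k) (CoordRing k V) :=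
  ((CoordRing.mk k V).comp
    (MvPolynomial.rename (Sum.inl : Fin t → Fin t ⊕ Fin r)).toRingHom).toAlgebra

/-- The `𝕂`-algebra `𝕂 ⊗ k[V]`, the tensor product being over `k[X₁, …, X_t]`. -/
abbrev GenericRing (k : Type*) [Field k] {t r : ℕ}
    (V : Set (Fin t ⊕ Fin r → AlgebraicClosure k)) : Type _ :=
  RatField k t ⊗[MvPolynomial (Fin t) k] CoordRing k V

/-- The class of a polynomial in `𝕂 ⊗ k[V]`. -/
def GenericRing.cls (k : Type*) [Field k] {t r : ℕ}
    (V : Set (Fin t ⊕ Fin r → AlgebraicClosure k)) (f : MvPolynomial (Fin t ⊕ Fin r) k) :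
    GenericRing k V :=
  1 ⊗ₜ[MvPolynomial (Fin t) k] CoordRing.mk k V f

/-- The linear form `∑ⱼ aⱼ X_{t+j}`. -/
def linForm {k : Type*} [Field k] (t : ℕ) {r : ℕ} (a : Fin r → k) :
    MvPolynomial (Fin t ⊕ Fin r) k :=
  ∑ j, MvPolynomial.C (a j) * MvPolynomial.X (Sum.inr j)

/-- The linear form with coefficients `a` is a primitive element of `𝕂 ⊗ k[V]` over `𝕂`. -/
def IsPrimitive (k : Type*) [Field k] {t r : ℕ}
    (V : Set (Fin t ⊕ Fin r → AlgebraicClosure k)) (a : Fin r → k) : Prop :=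
  Algebra.adjoin (RatField k t) {GenericRing.cls k V (linForm t a)} = ⊤

/-- `(q, w)` is the geometric resolution of `V`, with free variables `X₁, …, X_t`, associated with
the linear form `∑ⱼ aⱼ X_{t+j}`. -/
structure IsGeomRes (k : Type*) [Field k] {t r : ℕ}
    (V : Set (Fin t ⊕ Fin r → AlgebraicClosure k)) (a : Fin r → k)
    (q : Polynomial (RatField k t)) (w : Fin r → Polynomial (RatField k t)) : Prop where
  primitive : IsPrimitive k V a
  minpoly_eq : q = minpoly (RatField k t) (GenericRing.cls k V (linForm t a))
  degree_lt : ∀ j, (w j).degree < q.degree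
  coord : ∀ j, Polynomial.aeval (GenericRing.cls k V (linForm t a)) (w j) =
    GenericRing.cls k V (MvPolynomial.X (Sum.inr j))

/-! ## The algorithm `GeomResProj`, as a sequence of mathematical steps -/

/-- Steps 1 and 2: `p_{μ^0} = 1`, `p_μ = p`, `p_{μ^i} = p_μ * p_{μ^{i-1}} mod q`. -/
def powMod {F : Type*} [Field F] (q p : Polynomial F) : ℕ → Polynomial F
  | 0 => 1
  | 1 => p
  | (i + 2) => (p * powMod q p (i + 1)) %ₘ q

/-- Step 1: the polynomial `p_μ = ∑_{j ≤ s} μⱼ wⱼ`. -/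
def pMu {k : Type*} [Field k] {t r s : ℕ} (hsr : s ≤ r)
    (w : Fin r → Polynomial (RatField k t)) (mu : Fin s → k) : Polynomial (RatField k t) :=
  ∑ j, Polynomial.C (algebraMap k (RatField k t) (mu j)) * w (Fin.castLE hsr j)

/-- The vector of the first `D` coefficients of a polynomial. -/
def coeffVec {F : Type*} [Field F] (D : ℕ) (p : Polynomial F) : Fin D → F :=
  fun i => p.coeff i

/-- The `D × m` matrix with columns the coefficient vectors of `p_{μ^0}, …, p_{μ^{m-1}}`. -/
def powMatrix {F : Type*} [Field F] (D m : ℕ) (q p : Polynomial F) : Matrix (Fin D) (Fin m) F :=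
  Matrix.of fun i j => coeffVec D (powMod q p j) i

/-- Step 3: `δ`, the rank of the matrix of `p_{μ^0}, …, p_{μ^{D-1}}`. -/
def deltaRank {F : Type*} [Field F] (D : ℕ) (q p : Polynomial F) : ℕ :=
  (powMatrix D D q p).rank

/-- Steps 4 to 6: `(qmu, v)` is obtained from solutions of the linear systems
`P · a = p_{μ^δ}` and `P · bⱼ = wⱼ`, where `P` consists of the first `δ` columns, as
`qmu = Y^δ - ∑ aᵢ Y^i` and `vⱼ = ∑ bⱼᵢ Y^i`. -/
def IsGeomResProjOutput {k : Type*} [Field k] {t r s : ℕ} (hsr : s ≤ r) (D : ℕ)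
    (q : Polynomial (RatField k t)) (w : Fin r → Polynomial (RatField k t)) (mu : Fin s → k)
    (qmu : Polynomial (RatField k t)) (v : Fin s → Polynomial (RatField k t)) : Prop :=
  ∃ (a : Fin (deltaRank D q (pMu hsr w mu)) → RatField k t)
    (b : Fin s → Fin (deltaRank D q (pMu hsr w mu)) → RatField k t),
    (powMatrix D (deltaRank D q (pMu hsr w mu)) q (pMu hsr w mu)).mulVec a =
      coeffVec D (powMod q (pMu hsr w mu) (deltaRank D q (pMu hsr w mu))) ∧
    (∀ j, (powMatrix D (deltaRank D q (pMu hsr w mu)) q (pMu hsr w mu)).mulVec (b j) =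
      coeffVec D (w (Fin.castLE hsr j))) ∧
    qmu = Polynomial.X ^ (deltaRank D q (pMu hsr w mu)) -
      ∑ i, Polynomial.C (a i) * Polynomial.X ^ (i : ℕ) ∧
    ∀ j, v j = ∑ i, Polynomial.C (b j i) * Polynomial.X ^ (i : ℕ)

/-! ## Straight-line programs -/

/-- The four arithmetic operations. -/
inductive ArithOp : Type
  | add | sub | mul | div

/-- Value of an operation; division by zero is an error. -/
def ArithOp.eval {F : Type*} [Field F] : ArithOp → F → F → Option F
  | .add, x, y => some (x + y)
  | .sub, x, y => some (x - y)
  | .mul, x, y => some (x * y)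
  | .div, x, y => open Classical in if y = 0 then none else some (x / y)

/-- Operands of instructions: a scalar out of a list indexed by `κ`, an integer, one of the `t`
input variables, or the result of the `i`-th previous instruction (counted from `0`). -/
inductive Operand (κ : Type) (t : ℕ) : Type
  | scalar (c : κ)
  | int (z : ℤ)
  | var (i : Fin t)
  | res (i : ℕ)

/-- Value of an operand, given the values of the scalars, of the variables and the list of
results so far; a reference to a missing result is an error. -/
def Operand.eval {κ : Type} {t : ℕ} {F : Type*} [Field F] (c : κ → F) (x : Fin t → F)
    (l : List F) : Operand κ t → Option F
  | .scalar a => some (c a)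
  | .int z => some (z : F)
  | .var i => some (x i)
  | .res i => l[i]?

/-- An arithmetic instruction. -/
structure Instr (κ : Type) (t : ℕ) : Type where
  op : ArithOp
  fst : Operand κ t
  snd : Operand κ t

/-- Value of an instruction. -/
def Instr.eval {κ : Type} {t : ℕ} {F : Type*} [Field F] (c : κ → F) (x : Fin t → F)
    (l : List F) (I : Instr κ t) : Option F :=
  (I.fst.eval c x l).bind fun y => (I.snd.eval c x l).bind fun z => I.op.eval y z

/-- A straight-line program: a list of instructions. Its length is the length of the list. -/
abbrev SLP (κ : Type) (t : ℕ) : Type := List (Instr κ t)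

/-- Execution of a straight-line program, starting with a list of results: the list of all
results, or `none` in case of an error. -/
def SLP.run {κ : Type} {t : ℕ} {F : Type*} [Field F] (c : κ → F) (x : Fin t → F) :
    SLP κ t → List F → Option (List F)
  | [], l => some l
  | I :: P, l => (I.eval c x l).bind fun y => SLP.run c x P (l ++ [y])

/-- Execution over `k(X₁, …, X_t)` on the variables `X₁, …, X_t`, with scalars in `k`. -/
def SLP.runGeneric {k : Type*} [Field k] {κ : Type} {t : ℕ} (c : κ → k) (P : SLP κ t) :
    Option (List (RatField k t)) :=
  SLP.run (fun a => algebraMap k (RatField k t) (c a))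
    (fun i => algebraMap (MvPolynomial (Fin t) k) (RatField k t) (MvPolynomial.X i)) P []

/-- The operand `o` has value `f ∈ k(X₁, …, X_t)` after a generic execution with results `l`. -/
def Operand.HasValue {k : Type*} [Field k] {κ : Type} {t : ℕ} (c : κ → k)
    (l : List (RatField k t)) (o : Operand κ t) (f : RatField k t) : Prop :=
  o.eval (fun a => algebraMap k (RatField k t) (c a))
    (fun i => algebraMap (MvPolynomial (Fin t) k) (RatField k t) (MvPolynomial.X i)) l = some f

/-- A straight-line program together with the places where one finds the coefficients of
`Y^0, …, Y^{D-1}` of a monic polynomial of degree `D` and of `r` polynomials of degree `< D`. -/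
structure ResCode (κ : Type) (t r D : ℕ) : Type where
  prog : SLP κ t
  q : Fin D → Operand κ t
  w : Fin r → Fin D → Operand κ t

/-- The code, with scalars `c`, encodes the polynomials `q, w₁, …, w_r` in `k(X₁, …, X_t)[Y]`. -/
def ResCode.Encodes {k : Type*} [Field k] {κ : Type} {t r D : ℕ} (E : ResCode κ t r D) (c : κ → k)
    (q : Polynomial (RatField k t)) (w : Fin r → Polynomial (RatField k t)) : Prop :=
  q.Monic ∧ q.natDegree = D ∧ (∀ j, (w j).degree < (D : WithBot ℕ)) ∧
  ∃ l, E.prog.runGeneric c = some l ∧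
    (∀ i : Fin D, (E.q i).HasValue c l (q.coeff i)) ∧
    ∀ (j : Fin r) (i : Fin D), (E.w j i).HasValue c l ((w j).coeff i)

/-! ## Algebraic computation trees -/

/-- A computation tree: it performs arithmetic operations (whose results are stored one after the
other) and tests for zero, and ends in a leaf. Its variables are the random choices and its
scalars are the field elements of the input. -/
inductive CompTree (κ : Type) (t : ℕ) (α : Type) : Type
  | leaf (a : α)
  | comp (I : Instr κ t) (next : CompTree κ t α)
  | test (o : Operand κ t) (ifZero ifNonzero : CompTree κ t α)

/-- Worst-case number of operations and comparisons. -/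
def CompTree.cost {κ : Type} {t : ℕ} {α : Type} : CompTree κ t α → ℕ
  | .leaf _ => 0
  | .comp _ T => T.cost + 1
  | .test _ T₀ T₁ => max T₀.cost T₁.cost + 1

/-- Execution of a computation tree: the list of computed results and the leaf that is reached,
or `none` in case of an error. -/
def CompTree.run {κ : Type} {t : ℕ} {α : Type} {F : Type*} [Field F] (c : κ → F) (x : Fin t → F) :
    CompTree κ t α → List F → Option (List F × α)
  | .leaf a, l => some (l, a)
  | .comp I T, l => (I.eval c x l).bind fun y => CompTree.run c x T (l ++ [y])
  | .test o T₀ T₁, l => (o.eval c x l).bind fun y =>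
      open Classical in if y = 0 then CompTree.run c x T₀ l else CompTree.run c x T₁ l

/-- What an implementation of `GeomResProj` returns at a leaf: the number `δ`, a straight-line
program with the places of the coefficients of the output polynomials `(q_μ, v)`, the places of
the coefficients of the auxiliary polynomials `p_{μ^0}, …, p_{μ^D}` in the same program, and
the `m` scalars of the program, which are inputs or results of the computation. -/
structure ProjLeaf (κ : Type) (t s D : ℕ) : Type where
  m : ℕ
  scalars : Fin m → Operand κ t
  δ : ℕ
  code : ResCode (Fin m) t s δ
  pow : Fin (D + 1) → Fin D → Operand (Fin m) t

end

/-! Algebra. The projection induces an injection of `k[X₁, …, X_t]`-algebras from the coordinate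
ring of its closure into that of `V`. Tensoring with the flat module `𝕂` keeps it injective
(`genericRingMap_injective`), so `μ` has the same minimal polynomial in both generic rings. In `𝕂 ⊗
k[V]` the map sending a coefficient vector to its value at `λ` (`powComb D y`) is injective, because
`λ` has degree `D`, and it sends the vector of `p_{μ^i}` to `μ^i`. So the matrix of the algorithm
represents the powers of `μ`. Its rank is `dim 𝕂[μ] = deg minpoly μ` (`deltaRank_eq`), its first `δ`
columns are independent, and the two systems express `μ^δ` and the coordinates `X_j` in the basis
`1, …, μ^(δ-1)`.

Geometry. The components of the closure of the image are closures of images of components; the free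
variables stay independent on them, which with the injection of coordinate rings fixes the
dimension. Definability over `k` follows from the Nullstellensatz and a descent by `k`-linear
functionals on coefficients (`coordClosure_zeroLocus`).

Computation. Correctness and cost are proved for one explicit tree over an arbitrary field: products
modulo `q_λ` by Horner's rule, then Gaussian elimination in which each pivot remembers how it arises
from powers of `μ` (`IsElim`). The correctness statement is applied at the generic point, over `𝕂`.
Each generic branch decision and division remains valid off a hypersurface, so a run at a random `x`
reaches the same leaf (`CompTree.run_specialize`). That leaf contains the arithmetic instructions of
its path (`CompTree.withPath`), a straight-line program whose generic execution is the run already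
shown to be correct. The cost is cubic in `D` apart from `L` and `D²s`, and `Ω ≥ 3` absorbs it. -/

noncomputable section

/-! ## Computation trees as a monad -/

section Framework

variable {κ : Type} {t : ℕ} {α β : Type} {F : Type*} [Field F]

/-- Sequential composition of computation trees. -/
def CompTree.bind : CompTree κ t α → (α → CompTree κ t β) → CompTree κ t β
  | .leaf a, f => f a
  | .comp I T, f => .comp I (T.bind f)
  | .test o T₀ T₁, f => .test o (T₀.bind f) (T₁.bind f)

theorem CompTree.cost_bind_le {B : ℕ} (T : CompTree κ t α) {f : α → CompTree κ t β}
    (h : ∀ a, (f a).cost ≤ B) : (T.bind f).cost ≤ T.cost + B := by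
  induction T with
  | leaf a => simpa [CompTree.bind, CompTree.cost] using h a
  | comp I T ih => simp only [CompTree.bind, CompTree.cost]; omega
  | test o T₀ T₁ ih₀ ih₁ => simp only [CompTree.bind, CompTree.cost]; omega

theorem CompTree.cost_le_cost_bind (T : CompTree κ t α) (f : α → CompTree κ t β) :
    T.cost ≤ (T.bind f).cost := by
  induction T with
  | leaf a => exact Nat.zero_le _
  | comp I T ih => exact Nat.succ_le_succ ih
  | test o T₀ T₁ ih₀ ih₁ => exact Nat.succ_le_succ (max_le_max ih₀ ih₁)

theorem CompTree.run_bind (c : κ → F) (x : Fin t → F) (T : CompTree κ t α)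
    (f : α → CompTree κ t β) (l : List F) :
    (T.bind f).run c x l = (T.run c x l).bind fun p => (f p.2).run c x p.1 := by
  induction T generalizing l with
  | leaf a => rfl
  | comp I T ih =>
    simp only [CompTree.bind, CompTree.run]
    cases I.eval c x l <;> simp [ih]
  | test o T₀ T₁ ih₀ ih₁ =>
    simp only [CompTree.bind, CompTree.run]
    cases o.eval c x l with
    | none => rfl
    | some y => by_cases hy : y = 0 <;> simp [hy, ih₀, ih₁]

/-- Results are only ever appended, so an address keeps its value. This is the frame rule for all
later correctness proofs. -/
theorem Operand.eval_mono {c : κ → F} {x : Fin t → F} {l l' : List F} (h : l <+: l')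
    {o : Operand κ t} {y : F} (ho : o.eval c x l = some y) : o.eval c x l' = some y := by
  cases o with
  | res i =>
    obtain ⟨l₂, rfl⟩ := h
    simp only [Operand.eval] at ho ⊢
    rw [List.getElem?_append_left, ho]
    exact (List.getElem?_eq_some_iff.1 ho).1
  | _ => simpa [Operand.eval] using ho

/-- A computation: a family of trees indexed by the number of results stored at the start; the
leaves carry the number of results stored at the end. -/
def Comp (κ : Type) (t : ℕ) (α : Type) : Type := ℕ → CompTree κ t (ℕ × α)

namespace Comp

/-- The computation that returns `a`. -/
def pure (a : α) : Comp κ t α := fun N => .leaf (N, a)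

/-- Sequential composition. -/
def bind (T : Comp κ t α) (f : α → Comp κ t β) : Comp κ t β :=
  fun N => (T N).bind fun p => f p.2 p.1

/-- One arithmetic operation. -/
def op (o : ArithOp) (a b : Operand κ t) : Comp κ t (Operand κ t) :=
  fun N => .comp ⟨o, a, b⟩ (.leaf (N + 1, .res N))

/-- One comparison with zero. -/
def isZero (o : Operand κ t) : Comp κ t Bool :=
  fun N => .test o (.leaf (N, true)) (.leaf (N, false))

/-- Execution of a straight-line program. -/
def exec : SLP κ t → Comp κ t Unit
  | [] => pure ()
  | I :: P => fun N => .comp I (exec P (N + 1))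

/-- A family of computations, performed one after the other. -/
def vec : ∀ {m : ℕ}, (Fin m → Comp κ t α) → Comp κ t (Fin m → α)
  | 0, _ => pure Fin.elim0
  | _ + 1, f => bind (f 0) fun a => bind (vec fun i => f i.succ) fun g => pure (Fin.cons a g)

/-- The computation `T` takes at most `B` steps. -/
def CostLE (T : Comp κ t α) (B : ℕ) : Prop := ∀ N, (T N).cost ≤ B

theorem CostLE.mono {T : Comp κ t α} {B B' : ℕ} (h : CostLE T B) (hB : B ≤ B') : CostLE T B' :=
  fun N => (h N).trans hB

theorem costLE_pure (a : α) : CostLE (pure a : Comp κ t α) 0 := fun _ => le_rfl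

theorem CostLE.bind {T : Comp κ t α} {f : α → Comp κ t β} {B B' : ℕ} (h : CostLE T B)
    (h' : ∀ a, CostLE (f a) B') : CostLE (bind T f) (B + B') := fun N =>
  ((T N).cost_bind_le fun p => h' p.2 p.1).trans (Nat.add_le_add_right (h N) _)

theorem costLE_op (o : ArithOp) (a b : Operand κ t) : CostLE (op o a b) 1 := fun _ => le_rfl

theorem costLE_isZero (o : Operand κ t) : CostLE (isZero o) 1 := fun _ => le_rfl

theorem costLE_exec (P : SLP κ t) : CostLE (exec P) P.length := by
  induction P with
  | nil => exact costLE_pure ()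
  | cons I P ih => exact fun N => Nat.succ_le_succ (ih (N + 1))

theorem costLE_vec {m : ℕ} {f : Fin m → Comp κ t α} {B : ℕ} (h : ∀ i, CostLE (f i) B) :
    CostLE (vec f) (m * B) := by
  induction m with
  | zero => exact (costLE_pure _).mono (Nat.zero_le _)
  | succ m ih =>
    refine ((h 0).bind fun a => (ih fun i => h i.succ).bind fun g => costLE_pure _).mono ?_
    rw [Nat.succ_mul]; omega

/-- Started with results `l`, the computation `T` succeeds, and its outcome satisfies `Q`. -/
def Ok (c : κ → F) (x : Fin t → F) (T : Comp κ t α) (l : List F) (Q : List F → α → Prop) : Prop :=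
  -- The counter in the leaf must be the true number of stored results, since the next computation
  -- derives its addresses from it.
  ∃ l' a, (T l.length).run c x l = some (l', (l'.length, a)) ∧ l <+: l' ∧ Q l' a

variable {c : κ → F} {x : Fin t → F} {l : List F}

theorem Ok.mono {T : Comp κ t α} {Q Q' : List F → α → Prop} (h : Ok c x T l Q)
    (hQ : ∀ l' a, l <+: l' → Q l' a → Q' l' a) : Ok c x T l Q' := by
  obtain ⟨l', a, h₁, h₂, h₃⟩ := h
  exact ⟨l', a, h₁, h₂, hQ _ _ h₂ h₃⟩

theorem ok_pure {a : α} {Q : List F → α → Prop} (h : Q l a) : Ok c x (pure a) l Q :=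
  ⟨l, a, rfl, List.prefix_rfl, h⟩

theorem Ok.bind {T : Comp κ t α} {f : α → Comp κ t β} {Q : List F → α → Prop}
    {R : List F → β → Prop} (h : Ok c x T l Q)
    (h' : ∀ l' a, l <+: l' → Q l' a → Ok c x (f a) l' R) : Ok c x (bind T f) l R := by
  obtain ⟨l', a, h₁, h₂, h₃⟩ := h
  obtain ⟨l'', b, h₄, h₅, h₆⟩ := h' l' a h₂ h₃
  refine ⟨l'', b, ?_, h₂.trans h₅, h₆⟩
  simp only [Comp.bind, CompTree.run_bind, h₁]
  exact h₄

theorem ok_op {o : ArithOp} {a b : Operand κ t} {u v z : F} (ha : a.eval c x l = some u)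
    (hb : b.eval c x l = some v) (ho : o.eval u v = some z) :
    Ok c x (op o a b) l fun l' r => r.eval c x l' = some z := by
  refine ⟨l ++ [z], .res l.length, ?_, List.prefix_append _ _, ?_⟩
  · simp [op, CompTree.run, Instr.eval, ha, hb, ho]
  · simp [Operand.eval]

theorem ok_isZero {o : Operand κ t} {u : F} (ho : o.eval c x l = some u) :
    Ok c x (isZero o) l fun _ b => b = true ↔ u = 0 := by
  by_cases hu : u = 0
  · exact ⟨l, true, by simp [isZero, CompTree.run, ho, hu], List.prefix_rfl, by simp [hu]⟩
  · exact ⟨l, false, by simp [isZero, CompTree.run, ho, hu], List.prefix_rfl, by simp [hu]⟩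

theorem ok_exec {P : SLP κ t} {l' : List F} (h : SLP.run c x P l = some l') :
    Ok c x (exec P) l fun l'' _ => l'' = l' := by
  induction P generalizing l with
  | nil =>
    simp only [SLP.run, Option.some.injEq] at h
    exact ok_pure h
  | cons I P ih =>
    simp only [SLP.run, Option.bind_eq_some_iff] at h
    obtain ⟨y, hy, h⟩ := h
    obtain ⟨l'', a, h₁, h₂, h₃⟩ := ih h
    refine ⟨l'', a, ?_, (List.prefix_append _ _).trans h₂, h₃⟩
    simp only [exec, CompTree.run, hy]
    simpa using h₁

/-- `hQ` is needed because the postcondition of one component must survive the execution of the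
following ones. -/
theorem ok_vec {m : ℕ} {f : Fin m → Comp κ t α} {Q : Fin m → List F → α → Prop}
    (hQ : ∀ i l l' a, l <+: l' → Q i l a → Q i l' a)
    (h : ∀ i l', l <+: l' → Ok c x (f i) l' (Q i)) :
    Ok c x (vec f) l fun l' g => ∀ i, Q i l' (g i) := by
  induction m generalizing l with
  | zero => exact ok_pure fun i => i.elim0
  | succ m ih =>
    refine (h 0 l List.prefix_rfl).bind fun l₁ a h₁ ha => ?_
    refine (ih (fun i => hQ i.succ) fun i l' hl => h i.succ l' (h₁.trans hl)).bind
      fun l₂ g h₂ hg => ok_pure fun i => ?_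
    refine Fin.cases ?_ (fun j => ?_) i
    · simpa using hQ 0 _ _ _ h₂ ha
    · simpa using hg j

end Comp

/-! ### Vectors of operands -/

/-- The operands `o` have the values `v`. -/
def Vals {m : ℕ} (c : κ → F) (x : Fin t → F) (l : List F) (o : Fin m → Operand κ t)
    (v : Fin m → F) : Prop :=
  ∀ i, (o i).eval c x l = some (v i)

theorem Vals.mono {m : ℕ} {c : κ → F} {x : Fin t → F} {l l' : List F} {o : Fin m → Operand κ t}
    {v : Fin m → F} (h : Vals c x l o v) (hl : l <+: l') : Vals c x l' o v :=
  fun i => Operand.eval_mono hl (h i)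

namespace Comp

variable {c : κ → F} {x : Fin t → F} {l : List F} {m : ℕ}

theorem ok_vec_vals {f : Fin m → Comp κ t (Operand κ t)} {v : Fin m → F}
    (h : ∀ i l', l <+: l' → Ok c x (f i) l' fun l'' o => o.eval c x l'' = some (v i)) :
    Ok c x (vec f) l fun l' o => Vals c x l' o v :=
  ok_vec (Q := fun i l' (o : Operand κ t) => o.eval c x l' = some (v i))
    (fun _ _ _ _ hl ho => Operand.eval_mono hl ho) h

/-- `u - a * v` for vectors `u`, `v` and a scalar `a`. -/
def subMul (u : Fin m → Operand κ t) (a : Operand κ t) (v : Fin m → Operand κ t) :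
    Comp κ t (Fin m → Operand κ t) :=
  vec fun i => bind (op .mul a (v i)) fun y => op .sub (u i) y

theorem costLE_subMul (u : Fin m → Operand κ t) (a : Operand κ t) (v : Fin m → Operand κ t) :
    CostLE (subMul u a v) (m * 2) :=
  costLE_vec fun _ => (costLE_op _ _ _).bind fun _ => costLE_op _ _ _

theorem ok_subMul {u v : Fin m → Operand κ t} {a : Operand κ t} {u' v' : Fin m → F} {a' : F}
    (hu : Vals c x l u u') (hv : Vals c x l v v') (ha : a.eval c x l = some a') :
    Ok c x (subMul u a v) l fun l' o => Vals c x l' o (u' - a' • v') := by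
  refine ok_vec_vals fun i l' hl => ?_
  refine (ok_op (Operand.eval_mono hl ha) ((hv.mono hl) i) rfl).bind fun l₁ y h₁ hy => ?_
  exact ok_op ((hu.mono (hl.trans h₁)) i) hy (by simp [ArithOp.eval])

/-- Division of a vector by a scalar. -/
def divBy (u : Fin m → Operand κ t) (a : Operand κ t) : Comp κ t (Fin m → Operand κ t) :=
  vec fun i => op .div (u i) a

theorem costLE_divBy (u : Fin m → Operand κ t) (a : Operand κ t) :
    CostLE (divBy u a) (m * 1) := costLE_vec fun _ => costLE_op _ _ _

theorem ok_divBy {u : Fin m → Operand κ t} {a : Operand κ t} {u' : Fin m → F} {a' : F}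
    (hu : Vals c x l u u') (ha : a.eval c x l = some a') (h0 : a' ≠ 0) :
    Ok c x (divBy u a) l fun l' o => Vals c x l' o (a'⁻¹ • u') :=
  ok_vec_vals fun i _ hl => ok_op ((hu.mono hl) i) (Operand.eval_mono hl ha)
    (by simp [ArithOp.eval, h0, div_eq_inv_mul])

/-- The sum of the products `a j * b j`. -/
def dot : ∀ {m : ℕ}, (Fin m → Operand κ t) → (Fin m → Operand κ t) → Comp κ t (Operand κ t)
  | 0, _, _ => pure (.int 0)
  | _ + 1, a, b => bind (op .mul (a 0) (b 0)) fun y =>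
      bind (dot (fun i => a i.succ) fun i => b i.succ) fun z => op .add y z

theorem costLE_dot (a b : Fin m → Operand κ t) : CostLE (dot a b) (m * 2) := by
  induction m with
  | zero => exact (costLE_pure _).mono (Nat.zero_le _)
  | succ m ih =>
    refine ((costLE_op _ _ _).bind fun _ => (ih _ _).bind fun _ => costLE_op _ _ _).mono ?_
    omega

theorem ok_dot {a b : Fin m → Operand κ t} {a' b' : Fin m → F} (ha : Vals c x l a a')
    (hb : Vals c x l b b') :
    Ok c x (dot a b) l fun l' o => o.eval c x l' = some (∑ i, a' i * b' i) := by
  induction m generalizing l with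
  | zero => exact ok_pure (by simp [Operand.eval])
  | succ m ih =>
    refine (ok_op (ha 0) (hb 0) rfl).bind fun l₁ y h₁ hy => ?_
    refine (ih (fun i => (ha.mono h₁) i.succ) (fun i => (hb.mono h₁) i.succ)).bind
      fun l₂ z h₂ hz => ?_
    exact ok_op (Operand.eval_mono h₂ hy) hz (by simp [ArithOp.eval, Fin.sum_univ_succ])

/-- The first index where the vector `u` does not vanish, if there is one. -/
def findNonzero : ∀ {m : ℕ}, (Fin m → Operand κ t) → Comp κ t (Option (Fin m))
  | 0, _ => pure none
  | _ + 1, u => bind (isZero (u 0)) fun b => match b with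
    | false => pure (some 0)
    | true => bind (findNonzero fun i => u i.succ) fun o => pure (o.map Fin.succ)

theorem costLE_findNonzero (u : Fin m → Operand κ t) : CostLE (findNonzero u) m := by
  induction m with
  | zero => exact costLE_pure _
  | succ m ih =>
    refine ((costLE_isZero _).bind (B' := m) fun b => ?_).mono (by omega)
    cases b
    · exact (costLE_pure _).mono (Nat.zero_le _)
    · exact (ih _).bind fun _ => costLE_pure _

theorem ok_findNonzero {u : Fin m → Operand κ t} {u' : Fin m → F} (hu : Vals c x l u u') :
    Ok c x (findNonzero u) l fun _ o => (o = none ∧ u' = 0) ∨ ∃ i, o = some i ∧ u' i ≠ 0 := by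
  induction m generalizing l with
  | zero => exact ok_pure (Or.inl ⟨rfl, Subsingleton.elim _ _⟩)
  | succ m ih =>
    refine (ok_isZero (hu 0)).bind fun l₁ b h₁ hb => ?_
    cases b
    · exact ok_pure (Or.inr ⟨0, rfl, fun h => by simp [h] at hb⟩)
    · refine (ih (u' := fun i => u' i.succ) fun i => (hu.mono h₁) i.succ).bind
        fun l₂ o h₂ ho => ok_pure ?_
      rcases ho with ⟨rfl, ho⟩ | ⟨i, rfl, hi⟩
      · refine Or.inl ⟨rfl, funext fun i => ?_⟩
        refine Fin.cases ?_ (fun j => ?_) i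
        · exact hb.1 rfl
        · exact congrFun ho j
      · exact Or.inr ⟨i.succ, rfl, hi⟩

end Comp

end Framework

/-! ## The path of an execution -/

section Path

variable {κ κ' : Type} {t : ℕ} {α : Type} {F : Type*} [Field F]

/-- The tree `T`, with the arithmetic instructions on the way to a leaf (appended to `P`)
recorded there. -/
def CompTree.withPath : CompTree κ t α → SLP κ t → CompTree κ t (SLP κ t × α)
  | .leaf a, P => .leaf (P, a)
  | .comp I T, P => .comp I (T.withPath (P ++ [I]))
  | .test o T₀ T₁, P => .test o (T₀.withPath P) (T₁.withPath P)

theorem CompTree.cost_withPath (T : CompTree κ t α) (P : SLP κ t) :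
    (T.withPath P).cost = T.cost := by
  induction T generalizing P with
  | leaf a => rfl
  | comp I T ih => simp [withPath, cost, ih]
  | test o T₀ T₁ ih₀ ih₁ => simp [withPath, cost, ih₀, ih₁]

/-- Tests store nothing. Dropping those met on the way leaves a straight-line program with the same
results, no longer than the worst-case cost. -/
theorem CompTree.run_withPath {c : κ → F} {x : Fin t → F} {T : CompTree κ t α} {l l' : List F}
    {a : α} (h : T.run c x l = some (l', a)) (P : SLP κ t) :
    ∃ P' : SLP κ t, (T.withPath P).run c x l = some (l', (P ++ P', a)) ∧
      SLP.run c x P' l = some l' ∧ P'.length ≤ T.cost := by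
  induction T generalizing l P with
  | leaf a' =>
    simp only [run, Option.some.injEq, Prod.mk.injEq] at h
    obtain ⟨rfl, rfl⟩ := h
    exact ⟨[], by simp [withPath, run], rfl, le_rfl⟩
  | comp I T ih =>
    simp only [run, Option.bind_eq_some_iff] at h
    obtain ⟨y, hy, h⟩ := h
    obtain ⟨P', h₁, h₂, h₃⟩ := ih h (P ++ [I])
    refine ⟨I :: P', ?_, ?_, ?_⟩
    · simpa [withPath, run, hy] using h₁
    · simpa [SLP.run, hy] using h₂
    · simpa [cost] using h₃
  | test o T₀ T₁ ih₀ ih₁ =>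
    simp only [run, Option.bind_eq_some_iff] at h
    obtain ⟨y, hy, h⟩ := h
    by_cases h0 : y = 0
    · rw [if_pos h0] at h
      obtain ⟨P', h₁, h₂, h₃⟩ := ih₀ h P
      refine ⟨P', by simpa [withPath, run, hy, h0] using h₁, h₂, ?_⟩
      simp only [cost]; omega
    · rw [if_neg h0] at h
      obtain ⟨P', h₁, h₂, h₃⟩ := ih₁ h P
      refine ⟨P', by simpa [withPath, run, hy, h0] using h₁, h₂, ?_⟩
      simp only [cost]; omega

/-! ## Renaming of scalars -/

/-- Renaming of the scalars of an operand. -/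
def Operand.map (f : κ → κ') : Operand κ t → Operand κ' t
  | .scalar a => .scalar (f a)
  | .int z => .int z
  | .var i => .var i
  | .res i => .res i

theorem Operand.eval_map (f : κ → κ') (c : κ' → F) (x : Fin t → F) (l : List F)
    (o : Operand κ t) : (o.map f).eval c x l = o.eval (fun a => c (f a)) x l := by
  cases o <;> rfl

/-- Renaming of the scalars of a straight-line program. -/
def SLP.map (f : κ → κ') (P : SLP κ t) : SLP κ' t :=
  List.map (fun I => ⟨I.op, I.fst.map f, I.snd.map f⟩) P

theorem SLP.run_map (f : κ → κ') (c : κ' → F) (x : Fin t → F) (P : SLP κ t) (l : List F) :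
    SLP.run c x (P.map f) l = SLP.run (fun a => c (f a)) x P l := by
  induction P generalizing l with
  | nil => rfl
  | cons I P ih =>
    have : Instr.eval c x l ⟨I.op, I.fst.map f, I.snd.map f⟩ =
        I.eval (fun a => c (f a)) x l := by simp [Instr.eval, Operand.eval_map]
    simp only [SLP.map, List.map_cons, SLP.run, this] at ih ⊢
    exact congrArg _ (funext fun y => ih _)

theorem SLP.length_map (f : κ → κ') (P : SLP κ t) : (P.map f).length = P.length := by
  simp [SLP.map]

end Path

/-! ## Specialization of the variables -/

section Specialization

variable {k : Type*} [Field k] {κ : Type} {t : ℕ} {α : Type}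

/-- The rational function `f` is defined at `x`, with value `a`. -/
def SpecializesTo (x : Fin t → k) (f : RatField k t) (a : k) : Prop :=
  ∃ g h : MvPolynomial (Fin t) k, MvPolynomial.eval x h ≠ 0 ∧
    f * algebraMap _ (RatField k t) h = algebraMap _ (RatField k t) g ∧
    a * MvPolynomial.eval x h = MvPolynomial.eval x g

namespace SpecializesTo

variable {x : Fin t → k} {f f' : RatField k t} {a a' : k}

theorem algebraMap_eval (x : Fin t → k) (g : MvPolynomial (Fin t) k) :
    SpecializesTo x (algebraMap _ (RatField k t) g) (MvPolynomial.eval x g) :=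
  ⟨g, 1, by simp, by simp, by simp⟩

theorem const (x : Fin t → k) (b : k) : SpecializesTo x (algebraMap k (RatField k t) b) b := by
  have := algebraMap_eval x (MvPolynomial.C b)
  rwa [MvPolynomial.eval_C, ← MvPolynomial.algebraMap_eq,
    ← IsScalarTower.algebraMap_apply k (MvPolynomial (Fin t) k) (RatField k t)] at this

theorem intCast (x : Fin t → k) (z : ℤ) : SpecializesTo x (z : RatField k t) z := by
  simpa using algebraMap_eval x (z : MvPolynomial (Fin t) k)

theorem add (h : SpecializesTo x f a) (h' : SpecializesTo x f' a') :
    SpecializesTo x (f + f') (a + a') := by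
  obtain ⟨g, d, hd, hf, ha⟩ := h
  obtain ⟨g', d', hd', hf', ha'⟩ := h'
  refine ⟨g * d' + g' * d, d * d', by simp [hd, hd'], ?_, ?_⟩
  · simp only [map_add, map_mul, ← hf, ← hf']; ring
  · simp only [map_add, map_mul, ← ha, ← ha']; ring

theorem sub (h : SpecializesTo x f a) (h' : SpecializesTo x f' a') :
    SpecializesTo x (f - f') (a - a') := by
  obtain ⟨g, d, hd, hf, ha⟩ := h
  obtain ⟨g', d', hd', hf', ha'⟩ := h'
  refine ⟨g * d' - g' * d, d * d', by simp [hd, hd'], ?_, ?_⟩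
  · simp only [map_sub, map_mul, ← hf, ← hf']; ring
  · simp only [map_sub, map_mul, ← ha, ← ha']; ring

theorem mul (h : SpecializesTo x f a) (h' : SpecializesTo x f' a') :
    SpecializesTo x (f * f') (a * a') := by
  obtain ⟨g, d, hd, hf, ha⟩ := h
  obtain ⟨g', d', hd', hf', ha'⟩ := h'
  refine ⟨g * g', d * d', by simp [hd, hd'], ?_, ?_⟩
  · simp only [map_mul, ← hf, ← hf']; ring
  · simp only [map_mul, ← ha, ← ha']; ring

/-- A nonzero value means that the numerator does not vanish at `x`, so numerator and denominator
may be exchanged. -/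
theorem inv (h : SpecializesTo x f a) (ha : a ≠ 0) : SpecializesTo x f⁻¹ a⁻¹ := by
  obtain ⟨g, d, hd, hf, ha'⟩ := h
  have hg : MvPolynomial.eval x g ≠ 0 := by rw [← ha']; exact mul_ne_zero ha hd
  have hg' : algebraMap _ (RatField k t) g ≠ 0 := by
    rw [Ne, FaithfulSMul.algebraMap_eq_zero_iff]
    rintro rfl
    simp at hg
  have hf0 : f ≠ 0 := by rintro rfl; exact hg' (by rw [← hf, zero_mul])
  refine ⟨d, g, hg, ?_, ?_⟩
  · rw [← hf, inv_mul_cancel_left₀ hf0]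
  · rw [← ha', inv_mul_cancel_left₀ ha]

/-- Makes a generically successful zero test succeed at every admissible point, without a further
condition on `x`. -/
theorem eq_zero (h : SpecializesTo x 0 a) : a = 0 := by
  obtain ⟨g, d, hd, hf, ha⟩ := h
  rw [zero_mul, eq_comm, FaithfulSMul.algebraMap_eq_zero_iff] at hf
  simpa [hf, hd] using ha

end SpecializesTo

/-- `H` is the numerator of one fixed representation of `f`. The value at `x` may be witnessed by
another fraction, so the two are compared by cross-multiplication. -/
theorem exists_forall_specializesTo_ne_zero {f : RatField k t} (hf : f ≠ 0) :
    ∃ H : MvPolynomial (Fin t) k, H ≠ 0 ∧ ∀ x : Fin t → k, MvPolynomial.eval x H ≠ 0 →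
      ∀ a, SpecializesTo x f a → a ≠ 0 := by
  obtain ⟨n, d, hd, rfl⟩ := IsFractionRing.div_surjective (A := MvPolynomial (Fin t) k) f
  have hd0 : algebraMap _ (RatField k t) d ≠ 0 := by
    simpa using nonZeroDivisors.ne_zero hd
  have hn0 : n ≠ 0 := by rintro rfl; simp at hf
  refine ⟨n, hn0, fun x hx a ha ha0 => ?_⟩
  obtain ⟨g, h, hh, h₁, h₂⟩ := ha
  have : n * h = g * d := by
    apply FaithfulSMul.algebraMap_injective (MvPolynomial (Fin t) k) (RatField k t)
    rw [map_mul, map_mul, ← h₁]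
    field_simp
  have := congrArg (MvPolynomial.eval x) this
  rw [map_mul, map_mul, ← h₂, ha0, zero_mul, zero_mul] at this
  exact mul_ne_zero hx hh this

/-- The generic scalars. -/
abbrev genScalars (t : ℕ) (c : κ → k) : κ → RatField k t :=
  fun a => algebraMap k (RatField k t) (c a)

/-- The generic point. -/
abbrev genPoint (k : Type*) [Field k] (t : ℕ) : Fin t → RatField k t :=
  fun i => algebraMap (MvPolynomial (Fin t) k) (RatField k t) (MvPolynomial.X i)

variable {c : κ → k} {l : List (RatField k t)}

theorem Operand.eval_specializesTo {o : Operand κ t} {f : RatField k t}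
    (h : o.eval (genScalars t c) (genPoint k t) l = some f) {x : Fin t → k} {lx : List k}
    (hl : List.Forall₂ (SpecializesTo x) l lx) :
    ∃ a, o.eval c x lx = some a ∧ SpecializesTo x f a := by
  cases o with
  | scalar b =>
    simp only [Operand.eval, Option.some.injEq] at h ⊢
    exact ⟨_, rfl, h ▸ .const x _⟩
  | int z =>
    simp only [Operand.eval, Option.some.injEq] at h ⊢
    exact ⟨_, rfl, h ▸ .intCast x z⟩
  | var i =>
    simp only [Operand.eval, Option.some.injEq] at h ⊢
    exact ⟨_, rfl, by simpa [← h] using SpecializesTo.algebraMap_eval x (MvPolynomial.X i)⟩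
  | res i =>
    simp only [Operand.eval, List.getElem?_eq_some_iff] at h ⊢
    obtain ⟨hi, rfl⟩ := h
    have hi' : i < lx.length := hl.length_eq ▸ hi
    exact ⟨lx[i], ⟨hi', rfl⟩, hl.get hi hi'⟩

/-- Only a division excludes points: its divisor, nonzero generically, must stay nonzero at `x`. -/
theorem Instr.eval_specializesTo {I : Instr κ t} {f : RatField k t}
    (h : I.eval (genScalars t c) (genPoint k t) l = some f) :
    ∃ H : MvPolynomial (Fin t) k, H ≠ 0 ∧ ∀ x : Fin t → k, MvPolynomial.eval x H ≠ 0 →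
      ∀ lx, List.Forall₂ (SpecializesTo x) l lx →
        ∃ a, I.eval c x lx = some a ∧ SpecializesTo x f a := by
  obtain ⟨o, p, q⟩ := I
  simp only [Instr.eval, Option.bind_eq_some_iff] at h
  obtain ⟨u, hu, v, hv, h⟩ := h
  cases o
  case div =>
    simp only [ArithOp.eval] at h
    split_ifs at h with hv0
    simp only [Option.some.injEq] at h
    obtain ⟨H, hH, hx⟩ := exists_forall_specializesTo_ne_zero hv0
    refine ⟨H, hH, fun x hxH lx hl => ?_⟩
    obtain ⟨a, ha, hua⟩ := Operand.eval_specializesTo hu hl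
    obtain ⟨b, hb, hvb⟩ := Operand.eval_specializesTo hv hl
    have hb0 := hx x hxH b hvb
    exact ⟨a / b, by simp [Instr.eval, ha, hb, ArithOp.eval, hb0],
      by simpa only [← h, div_eq_mul_inv] using hua.mul (hvb.inv hb0)⟩
  all_goals
    simp only [ArithOp.eval, Option.some.injEq] at h
    refine ⟨1, one_ne_zero, fun x _ lx hl => ?_⟩
    obtain ⟨a, ha, hua⟩ := Operand.eval_specializesTo hu hl
    obtain ⟨b, hb, hvb⟩ := Operand.eval_specializesTo hv hl
    refine ⟨_, by simp only [Instr.eval, ha, hb, ArithOp.eval]; rfl, ?_⟩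
    rw [← h]
    first | exact hua.add hvb | exact hua.sub hvb | exact hua.mul hvb

/-- Off a hypersurface, a computation tree reaches the same leaf as at the generic point. -/
theorem CompTree.run_specialize {T : CompTree κ t α} {l' : List (RatField k t)} {a : α}
    (h : T.run (genScalars t c) (genPoint k t) l = some (l', a)) :
    ∃ H : MvPolynomial (Fin t) k, H ≠ 0 ∧ ∀ x : Fin t → k, MvPolynomial.eval x H ≠ 0 →
      ∀ lx, List.Forall₂ (SpecializesTo x) l lx → ∃ lx', T.run c x lx = some (lx', a) := by
  induction T generalizing l with
  | leaf b =>
    simp only [run, Option.some.injEq, Prod.mk.injEq] at h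
    exact ⟨1, one_ne_zero, fun x _ lx _ => ⟨lx, by simp [run, h.2]⟩⟩
  | comp I T ih =>
    simp only [run, Option.bind_eq_some_iff] at h
    obtain ⟨y, hy, h⟩ := h
    obtain ⟨H₁, hH₁, h₁⟩ := Instr.eval_specializesTo hy
    obtain ⟨H₂, hH₂, h₂⟩ := ih h
    refine ⟨H₁ * H₂, mul_ne_zero hH₁ hH₂, fun x hx lx hl => ?_⟩
    rw [map_mul, mul_ne_zero_iff] at hx
    obtain ⟨b, hb, hyb⟩ := h₁ x hx.1 lx hl
    obtain ⟨lx', hlx'⟩ := h₂ x hx.2 (lx ++ [b]) (List.rel_append hl (.cons hyb .nil))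
    exact ⟨lx', by simp [run, hb, hlx']⟩
  | test o T₀ T₁ ih₀ ih₁ =>
    simp only [run, Option.bind_eq_some_iff] at h
    obtain ⟨y, hy, h⟩ := h
    -- Only the branch taken generically matters. A zero outcome persists automatically; a nonzero
    -- one costs the factor `H₁`.
    by_cases h0 : y = 0
    · rw [if_pos h0] at h
      obtain ⟨H, hH, h₁⟩ := ih₀ h
      refine ⟨H, hH, fun x hx lx hl => ?_⟩
      obtain ⟨b, hb, hyb⟩ := Operand.eval_specializesTo hy hl
      obtain ⟨lx', hlx'⟩ := h₁ x hx lx hl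
      have hb0 : b = 0 := SpecializesTo.eq_zero (h0 ▸ hyb)
      exact ⟨lx', by simp [run, hb, hb0, hlx']⟩
    · rw [if_neg h0] at h
      obtain ⟨H₁, hH₁, h₁⟩ := exists_forall_specializesTo_ne_zero h0
      obtain ⟨H₂, hH₂, h₂⟩ := ih₁ h
      refine ⟨H₁ * H₂, mul_ne_zero hH₁ hH₂, fun x hx lx hl => ?_⟩
      rw [map_mul, mul_ne_zero_iff] at hx
      obtain ⟨b, hb, hyb⟩ := Operand.eval_specializesTo hy hl
      obtain ⟨lx', hlx'⟩ := h₂ x hx.2 lx hl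
      exact ⟨lx', by simp [run, hb, h₁ x hx.1 b hyb, hlx']⟩

end Specialization

/-! ## Gaussian elimination -/

section Elimination

/-- A pivot: a row, a reduced vector with entry `1` in this row, and the coefficients of this
vector as a combination of given vectors. -/
structure Pivot (D : ℕ) (α : Type*) where
  row : Fin D
  vec : Fin D → α
  comb : Fin (D + 1) → α

variable {D : ℕ} {F : Type*} [Field F]

/-- Successive elimination of the entries of `p.1` in the rows of the pivots. -/
def reduceBy : List (Pivot D F) → (Fin D → F) × (Fin (D + 1) → F) →
    (Fin D → F) × (Fin (D + 1) → F)
  | [], p => p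
  | π :: L, p => reduceBy L (p.1 - p.1 π.row • π.vec, p.2 - p.1 π.row • π.comb)

/-- Each pivot is a relation `φ vec + ψ comb = 0`, so subtracting multiples of pivots leaves `φ + ψ`
invariant. This is the bookkeeping behind the elimination. -/
theorem reduceBy_map_add {A : Type*} [AddCommGroup A] [Module F A] (φ : (Fin D → F) →ₗ[F] A)
    (ψ : (Fin (D + 1) → F) →ₗ[F] A) {L : List (Pivot D F)}
    (h : ∀ π ∈ L, φ π.vec + ψ π.comb = 0) (p : (Fin D → F) × (Fin (D + 1) → F)) :
    φ (reduceBy L p).1 + ψ (reduceBy L p).2 = φ p.1 + ψ p.2 := by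
  induction L generalizing p with
  | nil => rfl
  | cons π L ih =>
    rw [List.forall_mem_cons] at h
    rw [reduceBy, ih h.2]
    have : φ (p.1 - p.1 π.row • π.vec) + ψ (p.2 - p.1 π.row • π.comb) =
        φ p.1 + ψ p.2 - p.1 π.row • (φ π.vec + ψ π.comb) := by
      simp only [map_sub, map_smul, smul_add]; abel
    rw [this, h.1, smul_zero, sub_zero]

theorem reduceBy_comb {L : List (Pivot D F)} {b : Fin (D + 1)} (h : ∀ π ∈ L, π.comb b = 0)
    (p : (Fin D → F) × (Fin (D + 1) → F)) : (reduceBy L p).2 b = p.2 b := by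
  induction L generalizing p with
  | nil => rfl
  | cons π L ih =>
    rw [List.forall_mem_cons] at h
    rw [reduceBy, ih h.2]
    simp [h.1]

theorem reduceBy_vec {L : List (Pivot D F)} {i : Fin D} (h : ∀ π ∈ L, π.vec i = 0)
    (p : (Fin D → F) × (Fin (D + 1) → F)) : (reduceBy L p).1 i = p.1 i := by
  induction L generalizing p with
  | nil => rfl
  | cons π L ih =>
    rw [List.forall_mem_cons] at h
    rw [reduceBy, ih h.2]
    simp [h.1]

/-- A row, once cleared, stays cleared, because all later pivots vanish there. -/
theorem reduceBy_vec_row {L : List (Pivot D F)} (h₁ : ∀ π ∈ L, π.vec π.row = 1)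
    (h₂ : L.Pairwise fun π π' => π'.vec π.row = 0) (p : (Fin D → F) × (Fin (D + 1) → F)) :
    ∀ π ∈ L, (reduceBy L p).1 π.row = 0 := by
  induction L generalizing p with
  | nil => simp
  | cons π L ih =>
    rw [List.forall_mem_cons] at h₁ ⊢
    rw [List.pairwise_cons] at h₂
    refine ⟨?_, ih h₁.2 h₂.2 _⟩
    rw [reduceBy, reduceBy_vec h₂.1]
    simp [h₁.1]

/-- The span of the vectors of a list of pivots. -/
def pivotSpan (L : List (Pivot D F)) : Submodule F (Fin D → F) :=
  Submodule.span F {v | ∃ π ∈ L, π.vec = v}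

theorem vec_mem_pivotSpan {L : List (Pivot D F)} {π : Pivot D F} (h : π ∈ L) :
    π.vec ∈ pivotSpan L := Submodule.subset_span ⟨π, h, rfl⟩

theorem pivotSpan_mono {L L' : List (Pivot D F)} (h : L ⊆ L') : pivotSpan L ≤ pivotSpan L' :=
  Submodule.span_mono fun _ ⟨π, hπ, hv⟩ => ⟨π, h hπ, hv⟩

theorem sub_reduceBy_mem (L : List (Pivot D F)) (p : (Fin D → F) × (Fin (D + 1) → F)) :
    p.1 - (reduceBy L p).1 ∈ pivotSpan L := by
  induction L generalizing p with
  | nil => simp [reduceBy]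
  | cons π L ih =>
    have h := pivotSpan_mono (List.subset_cons_self π L)
      (ih (p.1 - p.1 π.row • π.vec, p.2 - p.1 π.row • π.comb))
    have h' := Submodule.smul_mem _ (p.1 π.row)
      (vec_mem_pivotSpan (List.mem_cons_self (a := π) (l := L)))
    rw [reduceBy]
    convert Submodule.add_mem _ h h' using 1
    simp only
    abel

/-- The later pivots vanish in the row of the first one, so the entry in that row is exactly the
coefficient of the first pivot. Subtracting it leaves a vector in the span of the rest. -/
theorem reduceBy_vec_eq_zero {L : List (Pivot D F)} (h₁ : ∀ π ∈ L, π.vec π.row = 1)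
    (h₂ : L.Pairwise fun π π' => π'.vec π.row = 0) {p : (Fin D → F) × (Fin (D + 1) → F)}
    (hp : p.1 ∈ pivotSpan L) : (reduceBy L p).1 = 0 := by
  induction L generalizing p with
  | nil => simpa [pivotSpan, reduceBy] using hp
  | cons π L ih =>
    rw [List.forall_mem_cons] at h₁
    rw [List.pairwise_cons] at h₂
    have hset : {v | ∃ π' ∈ π :: L, π'.vec = v} = insert π.vec {v | ∃ π' ∈ L, π'.vec = v} := by
      ext v; simp [eq_comm]
    rw [pivotSpan, hset, Submodule.mem_span_insert] at hp
    obtain ⟨a, y, hy, hp⟩ := hp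
    have hy0 : y π.row = 0 := by
      have : Submodule.span F {v | ∃ π' ∈ L, π'.vec = v} ≤
          LinearMap.ker (LinearMap.proj (R := F) (φ := fun _ : Fin D => F) π.row) := by
        rw [Submodule.span_le]
        rintro _ ⟨π', hπ', rfl⟩
        exact h₂.1 π' hπ'
      exact this hy
    have hrow : p.1 π.row = a := by simp [hp, h₁.1, hy0]
    rw [reduceBy]
    refine ih h₁.2 h₂.2 ?_
    simp only [hrow]
    rw [hp, add_sub_cancel_left]
    exact hy

/-! ### Coefficient vectors as elements of an algebra, and the elimination invariants -/

variable {A : Type*} [CommRing A] [Algebra F A]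

/-- The polynomial with a given vector of coefficients. -/
def finPoly (D : ℕ) : (Fin D → F) →ₗ[F] Polynomial F :=
  ∑ b : Fin D, Polynomial.monomial (b : ℕ) ∘ₗ LinearMap.proj b

theorem finPoly_apply (T : Fin D → F) :
    finPoly D T = ∑ b : Fin D, Polynomial.monomial (b : ℕ) (T b) := by
  simp [finPoly]

theorem coeff_finPoly (T : Fin D → F) {n : ℕ} (hn : n < D) :
    (finPoly D T).coeff n = T ⟨n, hn⟩ := by
  rw [finPoly_apply, Polynomial.finsetSum_coeff, Finset.sum_eq_single ⟨n, hn⟩]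
  · simp
  · intro b _ hb
    rw [Polynomial.coeff_monomial, if_neg]
    rintro rfl
    exact hb rfl
  · simp

theorem coeff_finPoly_eq_zero (T : Fin D → F) {n : ℕ} (hn : D ≤ n) :
    (finPoly D T).coeff n = 0 := by
  rw [finPoly_apply, Polynomial.finsetSum_coeff]
  refine Finset.sum_eq_zero fun b _ => ?_
  rw [Polynomial.coeff_monomial, if_neg]
  omega

/-- The element `∑ T_b μ^b` of an algebra. -/
def powComb (D : ℕ) (μ : A) : (Fin D → F) →ₗ[F] A :=
  (Polynomial.aeval μ).toLinearMap ∘ₗ finPoly D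

theorem powComb_apply (μ : A) (T : Fin D → F) :
    powComb D μ T = Polynomial.aeval μ (finPoly D T) := rfl

theorem powComb_eq_sum (μ : A) (T : Fin D → F) :
    powComb D μ T = ∑ b, T b • μ ^ (b : ℕ) := by
  rw [powComb_apply, finPoly_apply]
  simp [Polynomial.aeval_monomial, Algebra.smul_def]

/-- The properties of the list of pivots obtained from `1, μ, …, μ^(i-1)`. -/
structure IsElim (φ : (Fin D → F) →ₗ[F] A) (μ : A) (L : List (Pivot D F)) : Prop where
  one : ∀ π ∈ L, π.vec π.row = 1
  pairwise : L.Pairwise fun π π' => π'.vec π.row = 0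
  rel : ∀ π ∈ L, φ π.vec + powComb (D + 1) μ π.comb = 0
  supp : ∀ π ∈ L, ∀ b : Fin (D + 1), L.length ≤ b → π.comb b = 0
  span : ∀ b < L.length, μ ^ b ∈ (pivotSpan L).map φ

namespace IsElim

variable {φ : (Fin D → F) →ₗ[F] A} {μ : A} {L : List (Pivot D F)}

theorem nil (φ : (Fin D → F) →ₗ[F] A) (μ : A) : IsElim φ μ [] :=
  ⟨by simp, by simp, by simp, by simp, by simp⟩

theorem rel_reduceBy (h : IsElim φ μ L) (p : (Fin D → F) × (Fin (D + 1) → F)) :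
    φ (reduceBy L p).1 + powComb (D + 1) μ (reduceBy L p).2 =
      φ p.1 + powComb (D + 1) μ p.2 :=
  reduceBy_map_add φ _ h.rel p

theorem comb_reduceBy (h : IsElim φ μ L) (p : (Fin D → F) × (Fin (D + 1) → F)) {b : Fin (D + 1)}
    (hb : L.length ≤ b) : (reduceBy L p).2 b = p.2 b :=
  reduceBy_comb (fun π hπ => h.supp π hπ b hb) p

/-- With as many pivots as the degree of `μ`, their span maps onto a space containing all powers of
`μ` below that degree, hence all of `F[μ]`. Injectivity of `φ` pulls membership back to vectors. -/
theorem vec_reduceBy_eq_zero (h : IsElim φ μ L) (hφ : Function.Injective φ)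
    (hint : IsIntegral F μ) (hL : L.length = (minpoly F μ).natDegree)
    {p : (Fin D → F) × (Fin (D + 1) → F)} (hp : φ p.1 ∈ Algebra.adjoin F {μ}) :
    (reduceBy L p).1 = 0 := by
  refine reduceBy_vec_eq_zero h.one h.pairwise ?_
  rw [Algebra.adjoin_singleton_eq_range_aeval, AlgHom.mem_range] at hp
  obtain ⟨f, hf⟩ := hp
  have := hint.mem_span_pow ⟨f, hf.symm⟩
  have hle : Submodule.span F (Set.range fun i : Fin (minpoly F μ).natDegree => μ ^ (i : ℕ)) ≤
      (pivotSpan L).map φ := by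
    rw [Submodule.span_le]
    rintro _ ⟨i, rfl⟩
    exact h.span i (by rw [hL]; exact i.2)
  obtain ⟨m, hm, hmp⟩ := hle this
  rwa [← hφ hmp]

/-- A vanishing combination of the powers of `μ` with coefficient `-1` at `μ^i` and zeros beyond
is the negative of a monic polynomial of degree `i`. -/
theorem _root_.monic_neg_finPoly {T : Fin (D + 1) → F} {i : Fin (D + 1)} (hi : T i = -1)
    (hT : ∀ b, i < b → T b = 0) : (-finPoly (D + 1) T).Monic ∧
      (-finPoly (D + 1) T).natDegree = i := by
  have hc : ∀ n (hn : n < D + 1), (finPoly (D + 1) T).coeff n = T ⟨n, hn⟩ := fun n hn =>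
    coeff_finPoly T hn
  have hle : (-finPoly (D + 1) T).natDegree ≤ i := by
    rw [Polynomial.natDegree_le_iff_coeff_eq_zero]
    intro n hn
    rw [Polynomial.coeff_neg, neg_eq_zero]
    by_cases hnD : n < D + 1
    · rw [hc n hnD]; exact hT _ hn
    · exact coeff_finPoly_eq_zero T (not_lt.1 hnD)
  have hone : (-finPoly (D + 1) T).coeff i = 1 := by
    rw [Polynomial.coeff_neg, hc i i.2, Fin.eta, hi, neg_neg]
  refine ⟨Polynomial.monic_of_natDegree_le_of_coeff_eq_one i hle hone, hle.antisymm ?_⟩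
  exact Polynomial.le_natDegree_of_ne_zero (by rw [hone]; exact one_ne_zero)

/-- The pivots involve only powers below `μ^i`, so the initial entry `-1` at `i` is never changed
and nothing appears above it. -/
theorem monic_reduceBy (h : IsElim φ μ L) {i : Fin (D + 1)} (hi : (i : ℕ) = L.length)
    (m : Fin D → F) :
    (-finPoly (D + 1) (reduceBy L (m, -Pi.single i 1)).2).Monic ∧
      (-finPoly (D + 1) (reduceBy L (m, -Pi.single i 1)).2).natDegree = i := by
  refine monic_neg_finPoly ?_ fun b hb => ?_
  · rw [h.comb_reduceBy _ hi.ge]; simp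
  · have hb' : (i : ℕ) < b := hb
    rw [h.comb_reduceBy _ (by omega)]
    simp [hb.ne']

/-- The starting pair `(m, -e_i)` has invariant `φ m - μ^i = 0`. -/
theorem powComb_reduceBy (h : IsElim φ μ L) {i : Fin (D + 1)} {m : Fin D → F}
    (hm : φ m = μ ^ (i : ℕ)) :
    powComb (D + 1) μ (reduceBy L (m, -Pi.single i 1)).2 =
      -φ (reduceBy L (m, -Pi.single i 1)).1 := by
  rw [eq_neg_iff_add_eq_zero, add_comm, h.rel_reduceBy, map_neg, powComb_eq_sum, hm]
  simp [Pi.single_apply]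

/-- When the column of `μ^i` reduces to zero, the recorded combination is a relation among powers.
Its negative is monic of the minimal degree. -/
theorem minpoly_eq (h : IsElim φ μ L) (hφ : Function.Injective φ)
    (hint : IsIntegral F μ) (hL : L.length = (minpoly F μ).natDegree)
    {i : Fin (D + 1)} (hi : (i : ℕ) = L.length) {m : Fin D → F} (hm : φ m = μ ^ (i : ℕ)) :
    -finPoly (D + 1) (reduceBy L (m, -Pi.single i 1)).2 = minpoly F μ := by
  obtain ⟨hmon, hdeg⟩ := h.monic_reduceBy hi m
  refine minpoly.unique' F μ hmon ?_ fun q hq => ?_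
  · rw [map_neg, ← powComb_apply, h.powComb_reduceBy hm, neg_neg, h.vec_reduceBy_eq_zero hφ hint hL,
      map_zero]
    rw [hm]
    exact pow_mem (Algebra.self_mem_adjoin_singleton F μ) _
  · by_contra! hcon
    have := minpoly.degree_le_of_ne_zero F μ hcon.1 hcon.2
    rw [Polynomial.degree_eq_natDegree (minpoly.ne_zero hint), ← hL, ← hi, ← hdeg] at this
    rw [Polynomial.degree_eq_natDegree hmon.ne_zero] at hq
    exact absurd hq (not_lt.2 this)

/-- A column that reduces to zero yields a monic polynomial of degree `L.length` killing `μ`, so the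
elimination cannot stop too early. -/
theorem length_eq (h : IsElim φ μ L) (hL : L.length ≤ (minpoly F μ).natDegree)
    {i : Fin (D + 1)} (hi : (i : ℕ) = L.length) {m : Fin D → F} (hm : φ m = μ ^ (i : ℕ))
    (h0 : (reduceBy L (m, -Pi.single i 1)).1 = 0) : L.length = (minpoly F μ).natDegree := by
  obtain ⟨hmon, hdeg⟩ := h.monic_reduceBy hi m
  refine hL.antisymm ?_
  rw [← hi, ← hdeg]
  refine Polynomial.natDegree_le_natDegree (minpoly.min F μ hmon ?_)
  rw [map_neg, ← powComb_apply, h.powComb_reduceBy hm, h0, map_zero, neg_zero, neg_zero]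

theorem append (h : IsElim φ μ L) {i : Fin (D + 1)} (hi : (i : ℕ) = L.length) {m : Fin D → F}
    (hm : φ m = μ ^ (i : ℕ)) {ρ : Fin D} (hρ : (reduceBy L (m, -Pi.single i 1)).1 ρ ≠ 0) :
    IsElim φ μ (L ++ [⟨ρ, ((reduceBy L (m, -Pi.single i 1)).1 ρ)⁻¹ •
      (reduceBy L (m, -Pi.single i 1)).1, ((reduceBy L (m, -Pi.single i 1)).1 ρ)⁻¹ •
      (reduceBy L (m, -Pi.single i 1)).2⟩]) := by
  set p := reduceBy L (m, -Pi.single i 1) with hp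
  refine ⟨?_, ?_, ?_, ?_, ?_⟩
  · simp only [List.mem_append, List.mem_singleton]
    rintro π (hπ | rfl)
    · exact h.one π hπ
    · simp [hρ]
  · rw [List.pairwise_append]
    refine ⟨h.pairwise, List.pairwise_singleton _ _, ?_⟩
    simp only [List.mem_singleton, forall_eq]
    intro π hπ
    have := reduceBy_vec_row h.one h.pairwise (m, -Pi.single i 1) π hπ
    simp [hp, this]
  · simp only [List.mem_append, List.mem_singleton]
    rintro π (hπ | rfl)
    · exact h.rel π hπ
    · simp only [map_smul]
      rw [hp, h.powComb_reduceBy hm, ← smul_add, add_neg_cancel, smul_zero]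
  · simp only [List.mem_append, List.mem_singleton, List.length_append, List.length_singleton]
    rintro π (hπ | rfl) b hb
    · exact h.supp π hπ b (by omega)
    · have hne : b ≠ i := by rintro rfl; omega
      simp only [Pi.smul_apply]
      rw [hp, h.comb_reduceBy _ (by omega)]
      simp [hne]
  · intro b hb
    have hmono : pivotSpan L ≤ pivotSpan (L ++ [⟨ρ, (p.1 ρ)⁻¹ • p.1, (p.1 ρ)⁻¹ • p.2⟩]) :=
      pivotSpan_mono (List.subset_append_left _ _)
    rw [List.length_append, List.length_singleton, Nat.lt_succ_iff_lt_or_eq] at hb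
    rcases hb with hb | rfl
    · exact Submodule.map_mono hmono (h.span b hb)
    · refine ⟨m, ?_, by rw [hm, hi]⟩
      have h₁ := hmono (sub_reduceBy_mem L (m, -Pi.single i 1))
      have h₂ := vec_mem_pivotSpan (L := L ++ [⟨ρ, (p.1 ρ)⁻¹ • p.1, (p.1 ρ)⁻¹ • p.2⟩])
        (List.mem_append_right L List.mem_cons_self)
      have h₃ := Submodule.smul_mem _ (p.1 ρ) h₂
      rw [smul_inv_smul₀ hρ] at h₃
      simpa [← hp] using Submodule.add_mem _ h₁ h₃

end IsElim

end Elimination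

/-! ## The algorithm as a computation tree -/

section Algorithm

variable {κ : Type} {t D : ℕ} {F : Type*} [Field F] {c : κ → F} {x : Fin t → F} {l : List F}

namespace Comp

/-! ### Products modulo a monic polynomial -/

/-- The entry of a vector with the index before `h`, or zero. -/
def prevEntry (acc : Fin D → Operand κ t) (h : Fin D) : Operand κ t :=
  -- Multiplication by `Y` shifts the coefficients up by one, so a zero enters at index `0`.
  if (h : ℕ) = 0 then .int 0 else acc ⟨h - 1, (Nat.sub_le _ _).trans_lt h.2⟩

/-- The last entry of a vector. -/
def lastEntry (acc : Fin D → Operand κ t) (h : Fin D) : Operand κ t :=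
  acc ⟨D - 1, Nat.sub_lt (Nat.zero_lt_of_lt h.2) one_pos⟩

/-- Horner evaluation of `p * u` modulo the monic polynomial with lower coefficients `q`. -/
def mulMod (q u : Fin D → Operand κ t) :
    ∀ {m : ℕ}, (Fin m → Operand κ t) → Comp κ t (Fin D → Operand κ t)
  | 0, _ => pure fun _ => .int 0
  | _ + 1, p => bind (mulMod q u fun i => p i.succ) fun acc => vec fun h =>
      bind (op .mul (lastEntry acc h) (q h)) fun y => bind (op .sub (prevEntry acc h) y) fun z =>
        bind (op .mul (p 0) (u h)) fun y' => op .add z y'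

theorem costLE_mulMod (q u : Fin D → Operand κ t) {m : ℕ} (p : Fin m → Operand κ t) :
    CostLE (mulMod q u p) (m * (D * 4)) := by
  induction m with
  | zero => exact (costLE_pure _).mono (Nat.zero_le _)
  | succ m ih =>
    rw [Nat.succ_mul]
    exact (ih _).bind fun acc => costLE_vec fun h => (costLE_op _ _ _).bind fun _ =>
      (costLE_op _ _ _).bind fun _ => (costLE_op _ _ _).bind fun _ => costLE_op _ _ _

variable {A : Type*} [CommRing A] [Algebra F A]

/-- The result is described by its value at `y`, so the only fact needed about the modulus is that
it vanishes at `y`. The vector itself is identified later by injectivity of `powComb`. -/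
theorem ok_mulMod {q u : Fin D → Operand κ t} {m : ℕ} {p : Fin m → Operand κ t}
    {q' u' : Fin D → F} {p' : Fin m → F} (hq : Vals c x l q q') (hu : Vals c x l u u')
    (hp : Vals c x l p p') {y : A} (hy : y ^ D + powComb D y q' = 0) :
    Ok c x (mulMod q u p) l fun l' o =>
      ∃ v, Vals c x l' o v ∧ powComb D y v = powComb m y p' * powComb D y u' := by
  induction m generalizing l with
  | zero =>
    refine ok_pure ⟨0, fun i => by simp [Operand.eval], ?_⟩
    rw [powComb_eq_sum y p']
    simp
  | succ m ih =>
    refine (ih hq hu (p' := fun i => p' i.succ) fun i => hp i.succ).bind ?_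
    rintro l₁ acc h₁ ⟨v, hv, hvy⟩
    -- For `D = 0` there is no last entry; all vectors are empty and both sides are zero.
    cases D with
    | zero => exact (ok_vec_vals (v := Fin.elim0) fun i => i.elim0).mono fun l' o _ ho =>
        ⟨Fin.elim0, ho, by simp [powComb_eq_sum]⟩
    | succ D =>
      -- One Horner step: shift, replace the overflow `y ^ (D + 1)` by means of `q'`, then add `p' 0
      -- • u'`.
      let v' : Fin (D + 1) → F := fun h =>
        ((Fin.cons 0 (fun i : Fin D => v i.castSucc) : Fin (D + 1) → F) h - v (Fin.last D) * q' h)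
          + p' 0 * u' h
      refine (ok_vec_vals (v := v') fun h l₂ h₂ => ?_).mono fun l₃ o _ ho => ⟨v', ho, ?_⟩
      · refine (ok_op ((hv.mono h₂) (Fin.last D)) ((hq.mono (h₁.trans h₂)) h) rfl).bind
          fun l₃ y₁ h₃ hy₁ => ?_
        have hprev : (prevEntry acc h).eval c x l₃ =
            some ((Fin.cons 0 (fun i : Fin D => v i.castSucc) : Fin (D + 1) → F) h) := by
          refine Fin.cases ?_ (fun i => ?_) h
          · simp [prevEntry, Operand.eval]
          · exact (hv.mono (h₂.trans h₃)) i.castSucc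
        refine (ok_op hprev hy₁ rfl).bind fun l₄ y₂ h₄ hy₂ => ?_
        refine (ok_op ((hp.mono (h₁.trans (h₂.trans (h₃.trans h₄)))) 0)
          ((hu.mono (h₁.trans (h₂.trans (h₃.trans h₄)))) h) rfl).bind fun l₅ y₃ h₅ hy₃ => ?_
        exact ok_op (Operand.eval_mono h₅ hy₂) hy₃ rfl
      · have hsplit : v' = (Fin.cons 0 (fun i : Fin D => v i.castSucc) : Fin (D + 1) → F)
            - v (Fin.last D) • q' + p' 0 • u' := rfl
        have hcons : powComb (D + 1) y (Fin.cons 0 (fun i : Fin D => v i.castSucc)) =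
            y * powComb (D + 1) y v - v (Fin.last D) • y ^ (D + 1) := by
          rw [powComb_eq_sum, powComb_eq_sum, Fin.sum_univ_succ, Fin.sum_univ_castSucc, mul_add,
            Finset.mul_sum]
          simp [pow_succ']
        have hp0 : powComb (m + 1) y p' =
            algebraMap F A (p' 0) + y * powComb m y fun i => p' i.succ := by
          rw [powComb_eq_sum, powComb_eq_sum, Fin.sum_univ_succ, Finset.mul_sum]
          simp [pow_succ', Algebra.smul_def, mul_left_comm]
        rw [hsplit, map_add, map_sub, map_smul, map_smul, hcons, hvy, hp0,
          eq_neg_of_add_eq_zero_left hy]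
        simp only [Algebra.smul_def]
        ring

/-- The first `m` elements of the sequence `u, p * u, p * (p * u), …`, modulo the monic polynomial
with lower coefficients `q`. -/
def powers (q p : Fin D → Operand κ t) :
    ∀ m : ℕ, (Fin D → Operand κ t) → Comp κ t (Fin m → Fin D → Operand κ t)
  | 0, _ => pure Fin.elim0
  | m + 1, u => bind (mulMod q u p) fun u' => bind (powers q p m u') fun g => pure (Fin.cons u g)

/-- There is one product per listed vector; the last product is computed and discarded. -/
theorem costLE_powers (q p : Fin D → Operand κ t) (m : ℕ) (u : Fin D → Operand κ t) :
    CostLE (powers q p m u) (m * (D * (D * 4))) := by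
  induction m generalizing u with
  | zero => exact (costLE_pure _).mono (Nat.zero_le _)
  | succ m ih =>
    refine ((costLE_mulMod q u p).bind fun u' => (ih u').bind fun _ => costLE_pure _).mono ?_
    rw [Nat.succ_mul]; omega

theorem ok_powers {q p u : Fin D → Operand κ t} {q' p' u' : Fin D → F} (hq : Vals c x l q q')
    (hp : Vals c x l p p') (hu : Vals c x l u u') {y : A} (hy : y ^ D + powComb D y q' = 0)
    (m : ℕ) :
    Ok c x (powers q p m u) l fun l' g => ∀ i, ∃ v, Vals c x l' (g i) v ∧
      powComb D y v = powComb D y p' ^ (i : ℕ) * powComb D y u' := by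
  induction m generalizing l u u' with
  | zero => exact ok_pure fun i => i.elim0
  | succ m ih =>
    refine (ok_mulMod hq hu hp hy).bind ?_
    rintro l₁ u₁ h₁ ⟨v, hv, hvy⟩
    refine (ih (hq.mono h₁) (hp.mono h₁) hv).bind fun l₂ g h₂ hg => ok_pure fun i => ?_
    refine Fin.cases ?_ (fun j => ?_) i
    · exact ⟨u', hu.mono (h₁.trans h₂), by simp⟩
    · obtain ⟨v', hv', hvy'⟩ := hg j
      refine ⟨v', by simpa using hv', ?_⟩
      rw [hvy', hvy, Fin.val_succ, pow_succ, mul_assoc]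

/-! ### Elimination -/

/-- The pivot `π` has the values `π'`. -/
def PivotVals (c : κ → F) (x : Fin t → F) (l : List F) (π : Pivot D (Operand κ t))
    (π' : Pivot D F) : Prop :=
  π.row = π'.row ∧ Vals c x l π.vec π'.vec ∧ Vals c x l π.comb π'.comb

theorem forall₂_pivotVals_mono {l' : List F} (hl : l <+: l') {P : List (Pivot D (Operand κ t))}
    {P' : List (Pivot D F)} (h : List.Forall₂ (PivotVals c x l) P P') :
    List.Forall₂ (PivotVals c x l') P P' :=
  h.imp fun _ _ h => ⟨h.1, h.2.1.mono hl, h.2.2.mono hl⟩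

/-- Successive elimination of the entries of `p.1` in the rows of the pivots. -/
def reduce : List (Pivot D (Operand κ t)) → (Fin D → Operand κ t) × (Fin (D + 1) → Operand κ t) →
    Comp κ t ((Fin D → Operand κ t) × (Fin (D + 1) → Operand κ t))
  | [], p => pure p
  | π :: P, p => bind (subMul p.1 (p.1 π.row) π.vec) fun u =>
      bind (subMul p.2 (p.1 π.row) π.comb) fun T => reduce P (u, T)

theorem costLE_reduce (P : List (Pivot D (Operand κ t)))
    (p : (Fin D → Operand κ t) × (Fin (D + 1) → Operand κ t)) :
    CostLE (reduce P p) (P.length * (D * 2 + (D + 1) * 2)) := by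
  induction P generalizing p with
  | nil => exact (costLE_pure _).mono (Nat.zero_le _)
  | cons π P ih =>
    refine ((costLE_subMul _ _ _).bind fun u => (costLE_subMul _ _ _).bind fun T =>
      ih (u, T)).mono ?_
    rw [List.length_cons, Nat.succ_mul P.length]; omega

theorem ok_reduce {P : List (Pivot D (Operand κ t))} {P' : List (Pivot D F)}
    (hP : List.Forall₂ (PivotVals c x l) P P')
    {p : (Fin D → Operand κ t) × (Fin (D + 1) → Operand κ t)}
    {p' : (Fin D → F) × (Fin (D + 1) → F)} (h₁ : Vals c x l p.1 p'.1)
    (h₂ : Vals c x l p.2 p'.2) :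
    Ok c x (reduce P p) l fun l' o =>
      Vals c x l' o.1 (reduceBy P' p').1 ∧ Vals c x l' o.2 (reduceBy P' p').2 := by
  induction P generalizing l p p' P' with
  | nil => cases hP; exact ok_pure ⟨h₁, h₂⟩
  | cons π P ih =>
    obtain ⟨π', P', hπ, hP₂, rfl⟩ := List.forall₂_cons_left_iff.1 hP
    have hrow : (p.1 π.row).eval c x l = some (p'.1 π'.row) := by rw [← hπ.1]; exact h₁ _
    refine (ok_subMul h₁ hπ.2.1 hrow).bind fun l₁ u hl₁ hu => ?_
    refine (ok_subMul (h₂.mono hl₁) (hπ.2.2.mono hl₁)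
      (Operand.eval_mono hl₁ hrow)).bind fun l₂ T hl₂ hT => ?_
    exact ih (forall₂_pivotVals_mono (hl₁.trans hl₂) hP₂) (hu.mono hl₂) hT

/-- The outcome of the elimination: the degree of the minimal polynomial, its lower coefficients,
and the coefficients of polynomials. -/
structure ElimResult (κ : Type) (t s D : ℕ) : Type where
  deg : ℕ
  q : Fin (D + 1) → Operand κ t
  v : Fin s → Fin (D + 1) → Operand κ t

variable {s : ℕ}

/-- The vector with entry `-1` at `i` and zeros elsewhere. -/
def negUnit (i : Fin (D + 1)) : Fin (D + 1) → Operand κ t := fun b => .int (if b = i then -1 else 0)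

theorem vals_negUnit (i : Fin (D + 1)) :
    Vals c x l (negUnit i) (-Pi.single i 1 : Fin (D + 1) → F) := fun b => by
  by_cases h : b = i
  · subst h; simp [negUnit, Operand.eval]
  · simp [negUnit, Operand.eval, h]

/-- The last phase of the elimination, when all pivots are known. -/
def finish (cols : Fin (D + 1) → Fin D → Operand κ t) (w : Fin s → Fin D → Operand κ t)
    (P : List (Pivot D (Operand κ t))) : Comp κ t (ElimResult κ t s D) :=
  -- `Fin.ofNat` reduces modulo `D + 1`, which changes nothing as long as there are at most `D`
  -- pivots. Column `D` is needed when `μ` has degree `D`.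
  bind (reduce P (cols (Fin.ofNat (D + 1) P.length), negUnit (Fin.ofNat (D + 1) P.length)))
    fun p => bind (vec fun b => op .sub (.int 0) (p.2 b)) fun q =>
      bind (vec fun j => reduce P (w j, fun _ => .int 0)) fun v =>
        pure ⟨P.length, q, fun j => (v j).2⟩

/-- Elimination, with at most `f` further pivots. -/
def eliminate (cols : Fin (D + 1) → Fin D → Operand κ t) (w : Fin s → Fin D → Operand κ t) :
    ℕ → List (Pivot D (Operand κ t)) → Comp κ t (ElimResult κ t s D)
  | 0, P => finish cols w P
  | f + 1, P =>
    bind (reduce P (cols (Fin.ofNat (D + 1) P.length), negUnit (Fin.ofNat (D + 1) P.length)))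
      fun p => bind (findNonzero p.1) fun o => match o with
        | none => finish cols w P
        | some i => bind (divBy p.1 (p.1 i)) fun u => bind (divBy p.2 (p.1 i)) fun T =>
            eliminate cols w f (P ++ [⟨i, u, T⟩])

theorem costLE_finish (cols : Fin (D + 1) → Fin D → Operand κ t)
    (w : Fin s → Fin D → Operand κ t) {P : List (Pivot D (Operand κ t))} (hP : P.length ≤ D) :
    CostLE (finish cols w P) (D * (D * 2 + (D + 1) * 2) + ((D + 1) * 1 +
      s * (D * (D * 2 + (D + 1) * 2)))) :=
  ((costLE_reduce _ _).mono (Nat.mul_le_mul_right _ hP)).bind fun _ =>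
    (costLE_vec fun _ => costLE_op _ _ _).bind fun _ =>
      (costLE_vec fun _ => (costLE_reduce _ _).mono (Nat.mul_le_mul_right _ hP)).bind fun _ =>
        costLE_pure _

theorem costLE_eliminate (cols : Fin (D + 1) → Fin D → Operand κ t)
    (w : Fin s → Fin D → Operand κ t) {f : ℕ} {P : List (Pivot D (Operand κ t))}
    (hP : P.length + f = D) :
    CostLE (eliminate cols w f P) (f * (D * (D * 2 + (D + 1) * 2) + D + D + (D + 1)) +
      (D * (D * 2 + (D + 1) * 2) + ((D + 1) * 1 + s * (D * (D * 2 + (D + 1) * 2))))) := by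
  induction f generalizing P with
  | zero => exact (costLE_finish cols w (by omega)).mono (by omega)
  | succ f ih =>
    set B := D * (D * 2 + (D + 1) * 2) + ((D + 1) * 1 + s * (D * (D * 2 + (D + 1) * 2))) with hB
    set R := D * (D * 2 + (D + 1) * 2) with hR
    have hPD : P.length ≤ D := by omega
    -- `B'` bounds both branches: stopping now, or two normalizing divisions followed by the
    -- remaining rounds.
    refine (((costLE_reduce _ _).mono (Nat.mul_le_mul_right _ hPD)).bind fun p =>
      (costLE_findNonzero p.1).bind
        (B' := D * 1 + ((D + 1) * 1 + (f * (R + D + D + (D + 1)) + B))) fun o => ?_).mono ?_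
    · cases o with
      | none => exact (costLE_finish cols w hPD).mono (by omega)
      | some i =>
        exact (costLE_divBy _ _).bind fun u => (costLE_divBy _ _).bind fun T =>
          ih (by rw [List.length_append, List.length_singleton]; omega)
    · rw [← hR, Nat.succ_mul f]; omega

variable {μ : A} {φ : (Fin D → F) →ₗ[F] A}

/-- Correctness of the outcome of the elimination. -/
def IsElimResult (c : κ → F) (x : Fin t → F) (μ : A) (y : Fin s → A) (l : List F)
    (res : ElimResult κ t s D) : Prop :=
  res.deg = (minpoly F μ).natDegree ∧
  (∀ b : Fin (D + 1), (b : ℕ) < (minpoly F μ).natDegree →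
    (res.q b).eval c x l = some ((minpoly F μ).coeff b)) ∧
  ∀ j, ∃ T : Fin (D + 1) → F, Vals c x l (res.v j) T ∧ powComb (D + 1) μ T = y j ∧
    ∀ b : Fin (D + 1), (minpoly F μ).natDegree ≤ b → T b = 0

/-- The pair started at `(cols' i, -e_i)` ends as the minimal polynomial up to sign. A pair started
at `(w' j, 0)` ends with zero vector, so by the invariant its combination expresses `φ (w' j)` in
powers of `μ`. -/
theorem ok_finish {cols : Fin (D + 1) → Fin D → Operand κ t} {w : Fin s → Fin D → Operand κ t}
    {P : List (Pivot D (Operand κ t))} {P' : List (Pivot D F)}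
    {cols' : Fin (D + 1) → Fin D → F} {w' : Fin s → Fin D → F}
    (hP : List.Forall₂ (PivotVals c x l) P P') (hcols : ∀ i, Vals c x l (cols i) (cols' i))
    (hw : ∀ j, Vals c x l (w j) (w' j)) (hφ : Function.Injective φ) (hint : IsIntegral F μ)
    (hcμ : ∀ i : Fin (D + 1), φ (cols' i) = μ ^ (i : ℕ))
    (hwμ : ∀ j, φ (w' j) ∈ Algebra.adjoin F {μ}) (hE : IsElim φ μ P')
    (hdD : (minpoly F μ).natDegree ≤ D) (hlen : P'.length = (minpoly F μ).natDegree) :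
    Ok c x (finish cols w P) l (IsElimResult c x μ fun j => φ (w' j)) := by
  have hPP := hP.length_eq
  have hi : ((Fin.ofNat (D + 1) P.length : Fin (D + 1)) : ℕ) = P'.length := by
    rw [Fin.val_ofNat, Nat.mod_eq_of_lt (by omega), hPP]
  set i := Fin.ofNat (D + 1) P.length with hidef
  refine (ok_reduce hP (p' := (cols' i, -Pi.single i 1)) (hcols i) (vals_negUnit i)).bind
    fun l₁ p h₁ hp => ?_
  have hmin := hE.minpoly_eq hφ hint hlen hi (hcμ i)
  refine (ok_vec_vals (v := fun b => 0 - (reduceBy P' (cols' i, -Pi.single i 1)).2 b)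
    fun b l₂ h₂ => ok_op rfl ((hp.2.mono h₂) b) (by simp [ArithOp.eval])).bind
    fun l₂ q h₂ hq => ?_
  refine (ok_vec (Q := fun j l' (o : (Fin D → Operand κ t) × (Fin (D + 1) → Operand κ t)) =>
    Vals c x l' o.2 (reduceBy P' (w' j, 0)).2)
    (fun j l l' a hl h => h.mono hl) fun j l₃ h₃ => ?_).bind fun l₃ v h₃ hv => ok_pure ?_
  · have h := (h₁.trans h₂).trans h₃
    refine (ok_reduce (forall₂_pivotVals_mono h hP) (p' := (w' j, 0)) ((hw j).mono h)
      fun b => by simp [Operand.eval]).mono fun l' a _ ha => ha.2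
  · refine ⟨by rw [hPP, hlen], fun b hb => ?_, fun j => ⟨_, hv j, ?_, fun b hb => ?_⟩⟩
    · rw [← hmin, Polynomial.coeff_neg, coeff_finPoly _ b.2]
      simpa using (hq.mono h₃) b
    · have h := hE.rel_reduceBy (w' j, 0)
      rw [hE.vec_reduceBy_eq_zero hφ hint hlen (hwμ j)] at h
      simpa using h
    · rw [hE.comb_reduceBy _ (by omega)]; rfl

theorem ok_eliminate {cols : Fin (D + 1) → Fin D → Operand κ t} {w : Fin s → Fin D → Operand κ t}
    {f : ℕ} {P : List (Pivot D (Operand κ t))} {P' : List (Pivot D F)}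
    {cols' : Fin (D + 1) → Fin D → F} {w' : Fin s → Fin D → F}
    (hP : List.Forall₂ (PivotVals c x l) P P') (hcols : ∀ i, Vals c x l (cols i) (cols' i))
    (hw : ∀ j, Vals c x l (w j) (w' j)) (hφ : Function.Injective φ) (hint : IsIntegral F μ)
    (hcμ : ∀ i : Fin (D + 1), φ (cols' i) = μ ^ (i : ℕ))
    (hwμ : ∀ j, φ (w' j) ∈ Algebra.adjoin F {μ}) (hE : IsElim φ μ P')
    (hdD : (minpoly F μ).natDegree ≤ D) (hlen : P'.length ≤ (minpoly F μ).natDegree)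
    (hf : P'.length + f = D) :
    Ok c x (eliminate cols w f P) l (IsElimResult c x μ fun j => φ (w' j)) := by
  induction f generalizing l P P' with
  -- Without remaining rounds there are `D` pivots, and `D` bounds the degree of `μ`, so the degree
  -- has been reached.
  | zero => exact ok_finish hP hcols hw hφ hint hcμ hwμ hE hdD (by omega)
  | succ f ih =>
    have hPP := hP.length_eq
    have hi : ((Fin.ofNat (D + 1) P.length : Fin (D + 1)) : ℕ) = P'.length := by
      rw [Fin.val_ofNat, Nat.mod_eq_of_lt (by omega), hPP]
    rw [eliminate]
    set i := Fin.ofNat (D + 1) P.length with hidef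
    refine (ok_reduce hP (p' := (cols' i, -Pi.single i 1)) (hcols i) (vals_negUnit i)).bind
      fun l₁ p h₁ hp => ?_
    refine (ok_findNonzero hp.1).bind fun l₂ o h₂ ho => ?_
    have h₁₂ := h₁.trans h₂
    rcases ho with ⟨rfl, ho⟩ | ⟨ρ, rfl, hρ⟩
    · exact ok_finish (forall₂_pivotVals_mono h₁₂ hP) (fun i => (hcols i).mono h₁₂)
        (fun j => (hw j).mono h₁₂) hφ hint hcμ hwμ hE hdD (hE.length_eq hlen hi (hcμ i) ho)
    -- A nonzero remainder shows that the degree is not yet reached, so one more pivot keeps the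
    -- bound on the length.
    · have hne : P'.length ≠ (minpoly F μ).natDegree := fun h => hρ <| by
        rw [hE.vec_reduceBy_eq_zero hφ hint h]
        · rfl
        · rw [hcμ]; exact pow_mem (Algebra.self_mem_adjoin_singleton F μ) _
      have hpρ := hp.1 ρ
      refine (ok_divBy (hp.1.mono h₂) (Operand.eval_mono h₂ hpρ) hρ).bind fun l₃ u h₃ hu => ?_
      refine (ok_divBy (hp.2.mono (h₂.trans h₃)) (Operand.eval_mono (h₂.trans h₃) hpρ) hρ).bind
        fun l₄ T h₄ hT => ?_
      have h := h₁₂.trans (h₃.trans h₄)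
      refine ih ?_ (fun i => (hcols i).mono h) (fun j => (hw j).mono h)
        (hE.append hi (hcμ i) hρ) ?_ ?_
      · exact List.rel_append (forall₂_pivotVals_mono h hP)
          (.cons ⟨rfl, hu.mono h₄, hT⟩ .nil)
      · rw [List.length_append, List.length_singleton]; omega
      · rw [List.length_append, List.length_singleton]; omega

end Comp

end Algorithm

/-! ### The complete tree and the straight-line program at its leaves -/

section Tree

variable {t r s D n : ℕ} {F : Type*} [Field F]

namespace Comp

/-- The places of the coefficients of `w_j`, with scalars in a larger set. -/
def projEntry (E : ResCode (Fin n) t r D) (j : Fin s) : Fin D → Operand (Fin n ⊕ Fin s) t :=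
  -- The tree is defined for all `s` and `r`; the default is never reached when `s ≤ r`.
  if h : (j : ℕ) < r then fun i => (E.w ⟨j, h⟩ i).map Sum.inl else fun _ => .int 0

/-- The first coordinate vector. -/
def firstUnit (κ : Type) (t D : ℕ) : Fin D → Operand κ t :=
  fun i => .int (if (i : ℕ) = 0 then 1 else 0)

/-- The algorithm `GeomResProj`. -/
def geomResProj (E : ResCode (Fin n) t r D) : Comp (Fin n ⊕ Fin s) t
    (ElimResult (Fin n ⊕ Fin s) t s D × (Fin (D + 1) → Fin D → Operand (Fin n ⊕ Fin s) t)) :=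
  bind (exec (E.prog.map Sum.inl)) fun _ =>
    bind (vec fun h => dot (fun j : Fin s => .scalar (Sum.inr j)) fun j => projEntry E j h)
      fun p => bind (powers (fun i => (E.q i).map Sum.inl) p (D + 1) (firstUnit _ t D))
        fun g => bind (eliminate g (projEntry E) D []) fun res => pure (res, g)

theorem costLE_geomResProj (E : ResCode (Fin n) t r D) (hD : 0 < D) :
    CostLE (geomResProj (s := s) E) (E.prog.length + 26 * D ^ 3 + 8 * (D ^ 2 * s)) := by
  have h₁ := costLE_exec (E.prog.map (Sum.inl : Fin n → Fin n ⊕ Fin s))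
  rw [SLP.length_map] at h₁
  refine (h₁.bind fun _ => (costLE_vec fun h => costLE_dot _ _).bind fun p =>
    (costLE_powers _ _ _ _).bind fun g => (costLE_eliminate g (projEntry E)
      (P := []) (Nat.zero_add D)).bind fun res => costLE_pure _).mono ?_
  generalize E.prog.length = L
  obtain ⟨d, hd⟩ := Nat.exists_eq_add_of_lt hD
  rw [zero_add] at hd
  simp only [hd]
  -- Apart from `L` the sum is `8D³ + 13D² + 4D + 1 + 4D²s + 4Ds`. For `D = d + 1 ≥ 1` this is at
  -- most `26D³ + 8D²s`, since `8 + 13 + 4 + 1 = 26`.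
  nlinarith [Nat.zero_le (d ^ 3), Nat.zero_le (d ^ 2), Nat.zero_le (d * s),
    Nat.zero_le (d ^ 2 * s)]

variable {A : Type*} [CommRing A] [Algebra F A]

/-- Stated for an abstract algebra with elements `y` (for `λ`) and `μ`. Vectors of length `D` are
faithful names of elements by `hinj`, so arithmetic with them is arithmetic in `A`. -/
theorem ok_geomResProj {c : Fin n → F} {m : Fin s → F} {x : Fin t → F}
    {E : ResCode (Fin n) t r D} (hsr : s ≤ r) {l₀ : List F} (hrun : SLP.run c x E.prog [] = some l₀)
    {q' : Fin D → F} {w' : Fin r → Fin D → F} (hq : Vals c x l₀ E.q q')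
    (hw : ∀ j, Vals c x l₀ (E.w j) (w' j)) (hD : 0 < D) {y μ : A}
    (hinj : Function.Injective (powComb (F := F) D y)) (hy : y ^ D + powComb D y q' = 0)
    (hμ : μ = ∑ j, m j • powComb D y (w' (Fin.castLE hsr j))) (hint : IsIntegral F μ)
    (hdD : (minpoly F μ).natDegree ≤ D)
    (hadj : ∀ j, powComb D y (w' (Fin.castLE hsr j)) ∈ Algebra.adjoin F {μ}) :
    Ok (Sum.elim c m) x (geomResProj E) [] fun l' res =>
      IsElimResult (Sum.elim c m) x μ (fun j => powComb D y (w' (Fin.castLE hsr j))) l' res.1 ∧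
      ∀ i, ∃ v, Vals (Sum.elim c m) x l' (res.2 i) v ∧ powComb D y v = μ ^ (i : ℕ) := by
  refine (ok_exec (l' := l₀) (by simpa [SLP.run_map] using hrun)).bind ?_
  rintro l₀ - - rfl
  have hq₀ : Vals (Sum.elim c m) x l₀ (fun i => (E.q i).map Sum.inl) q' := fun i => by
    rw [Operand.eval_map]; exact hq i
  have hw₀ : ∀ j : Fin s, Vals (Sum.elim c m) x l₀ (projEntry E j) (w' (Fin.castLE hsr j)) :=
    fun j i => by
      rw [projEntry, dif_pos (j.2.trans_le hsr), Operand.eval_map]; exact hw _ i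
  refine (ok_vec_vals (v := fun h => ∑ j, m j * w' (Fin.castLE hsr j) h) fun h l₁ h₁ =>
    ok_dot (a := fun j => .scalar (Sum.inr j)) (fun j => by simp [Operand.eval])
      fun j => ((hw₀ j).mono h₁) h).bind fun l₁ p h₁ hp => ?_
  have hpμ : powComb D y (fun h => ∑ j, m j * w' (Fin.castLE hsr j) h) = μ := by
    have : (fun h => ∑ j, m j * w' (Fin.castLE hsr j) h) =
        ∑ j, m j • w' (Fin.castLE hsr j) := by ext h; simp
    rw [this, map_sum, hμ]
    simp only [map_smul]
  have hu : Vals (Sum.elim c m) x l₁ (firstUnit _ t D) (Pi.single ⟨0, hD⟩ 1) := fun i => by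
    by_cases h : i = ⟨0, hD⟩
    · subst h; simp [firstUnit, Operand.eval]
    · have h' : (i : ℕ) ≠ 0 := fun h0 => h (Fin.ext h0)
      simp [firstUnit, Operand.eval, h, h']
  have hu1 : powComb (F := F) D y (Pi.single ⟨0, hD⟩ 1) = 1 := by
    rw [powComb_eq_sum]
    simp [Pi.single_apply]
  refine (ok_powers (hq₀.mono h₁) hp hu hy (D + 1)).bind fun l₂ g h₂ hg => ?_
  simp only [hpμ, hu1, mul_one] at hg
  choose v hv hvμ using hg
  refine (ok_eliminate (P' := []) .nil hv (fun j => (hw₀ j).mono (h₁.trans h₂)) hinj hint hvμ hadj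
    (IsElim.nil _ _) hdD (Nat.zero_le _) (Nat.zero_add D)).bind fun l₃ res h₃ hres => ok_pure ?_
  exact ⟨hres, fun i => ⟨v i, (hv i).mono h₃, hvμ i⟩⟩

end Comp

/-- The output at a leaf: the arithmetic instructions performed on the way to it form a
straight-line program. -/
def ProjLeaf.ofPath (P : SLP (Fin n ⊕ Fin s) t) (res : Comp.ElimResult (Fin n ⊕ Fin s) t s D)
    (g : Fin (D + 1) → Fin D → Operand (Fin n ⊕ Fin s) t) : ProjLeaf (Fin n ⊕ Fin s) t s D where
  -- The scalars are just the inputs: values computed at the random point serve only to choose the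
  -- branch.
  m := n + s
  scalars i := .scalar (finSumFinEquiv.symm i)
  δ := res.deg
  code :=
    { prog := P.map finSumFinEquiv
      q := fun i => (res.q (Fin.ofNat (D + 1) i)).map finSumFinEquiv
      w := fun j i => (res.v j (Fin.ofNat (D + 1) i)).map finSumFinEquiv }
  pow i h := (g i h).map finSumFinEquiv

/-- The algorithm `GeomResProj`, with the straight-line program it produces. -/
def geomResProjTree (t r s D n : ℕ) (E : ResCode (Fin n) t r D) :
    CompTree (Fin n ⊕ Fin s) t (ProjLeaf (Fin n ⊕ Fin s) t s D) :=
  ((Comp.geomResProj E 0).withPath []).bind fun p => .leaf (.ofPath p.1 p.2.2.1 p.2.2.2)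

theorem cost_geomResProjTree_le (E : ResCode (Fin n) t r D) (hD : 0 < D) :
    (geomResProjTree t r s D n E).cost ≤ E.prog.length + 26 * D ^ 3 + 8 * (D ^ 2 * s) := by
  refine (CompTree.cost_bind_le (B := 0) _ fun _ => le_rfl).trans ?_
  rw [CompTree.cost_withPath]
  exact Comp.costLE_geomResProj E hD 0

theorem run_geomResProjTree {c : Fin n ⊕ Fin s → F} {x : Fin t → F} {E : ResCode (Fin n) t r D}
    {Q : List F → Comp.ElimResult (Fin n ⊕ Fin s) t s D ×
      (Fin (D + 1) → Fin D → Operand (Fin n ⊕ Fin s) t) → Prop}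
    (h : Comp.Ok c x (Comp.geomResProj E) [] Q) :
    ∃ l P a, (geomResProjTree t r s D n E).run c x [] = some (l, .ofPath P a.1 a.2) ∧
      SLP.run c x P [] = some l ∧ P.length ≤ (geomResProjTree t r s D n E).cost ∧ Q l a := by
  obtain ⟨l, a, h₁, -, h₂⟩ := h
  obtain ⟨P, h₃, h₄, h₅⟩ := CompTree.run_withPath h₁ []
  refine ⟨l, P, a, ?_, h₄, h₅.trans ?_, h₂⟩
  · rw [geomResProjTree, CompTree.run_bind]
    simp only [List.length_nil, List.nil_append] at h₃
    rw [h₃]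
    rfl
  · rw [← CompTree.cost_withPath _ []]
    exact CompTree.cost_le_cost_bind _ _

end Tree

/-! ## Zariski closed sets and projections -/

section Zariski

open MvPolynomial

variable {F σ τ : Type*} [Field F]

theorem subset_zariskiClosure (S : Set (σ → F)) : S ⊆ zariskiClosure S :=
  zeroLocus_vanishingIdeal_le S

theorem isZariskiClosed_zeroLocus {k : Type*} [Field k] [Algebra k F]
    (I : Ideal (MvPolynomial σ k)) :
    IsZariskiClosed (zeroLocus F I) := by
  refine Set.Subset.antisymm (fun x hx p hp => ?_) (subset_zariskiClosure _)
  have := hx (map (algebraMap k F) p) fun z hz => by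
    rw [aeval_map_algebraMap]; exact hz p hp
  rwa [aeval_map_algebraMap] at this

theorem isZariskiClosed_zariskiClosure (S : Set (σ → F)) : IsZariskiClosed (zariskiClosure S) :=
  isZariskiClosed_zeroLocus _

theorem IsZariskiClosed.zariskiClosure_subset {S W : Set (σ → F)} (hW : IsZariskiClosed W)
    (h : S ⊆ W) : zariskiClosure S ⊆ W := by
  rw [← hW]
  exact zeroLocus_anti_mono (vanishingIdeal_anti_mono h)

theorem zariskiClosure_mono {S S' : Set (σ → F)} (h : S ⊆ S') :
    zariskiClosure S ⊆ zariskiClosure S' :=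
  (isZariskiClosed_zariskiClosure S').zariskiClosure_subset
    (h.trans (subset_zariskiClosure S'))

theorem vanishingIdeal_zariskiClosure {k : Type*} [Field k] [Algebra k F] (S : Set (σ → F)) :
    vanishingIdeal k (zariskiClosure S) = vanishingIdeal k S := by
  refine le_antisymm (vanishingIdeal_anti_mono (subset_zariskiClosure S)) fun p hp x hx => ?_
  have := hx (map (algebraMap k F) p) fun z hz => by
    rw [aeval_map_algebraMap]; exact hp z hz
  rwa [aeval_map_algebraMap] at this

theorem IsZariskiClosed.eq_zeroLocus {W : Set (σ → F)} (hW : IsZariskiClosed W) :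
    W = zeroLocus F (vanishingIdeal F W) := hW.symm

theorem IsIrredClosed.isPrime_vanishingIdeal {W : Set (σ → F)} (hW : IsIrredClosed W) :
    (vanishingIdeal F W).IsPrime := by
  obtain ⟨hc, ⟨z, hz⟩, hirr⟩ := hW
  refine ⟨fun h => ?_, fun {f g} hfg => ?_⟩
  · have : (1 : MvPolynomial σ F) ∈ vanishingIdeal F W := h ▸ Submodule.mem_top
    simpa using this z hz
  · have hsub : W ⊆ zeroLocus F (Ideal.span {f}) ∪ zeroLocus F (Ideal.span {g}) := fun y hy => by
      have := hfg y hy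
      rw [map_mul, mul_eq_zero] at this
      simpa [zeroLocus_span] using this
    refine (hirr _ _ (isZariskiClosed_zeroLocus _) (isZariskiClosed_zeroLocus _) hsub).imp ?_ ?_ <;>
    · intro h y hy
      exact h hy _ (Ideal.subset_span rfl)

/-- By the Nullstellensatz the vanishing ideal of the zero locus of a prime `P` is `P`, so a
covering by two closed sets becomes an intersection of ideals inside a prime. -/
theorem isIrredClosed_zeroLocus [IsAlgClosed F] [Finite σ] (P : Ideal (MvPolynomial σ F))
    [hP : P.IsPrime] : IsIrredClosed (zeroLocus F P) := by
  refine ⟨isZariskiClosed_zeroLocus P, ?_, fun W₁ W₂ h₁ h₂ hW => ?_⟩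
  · rw [Set.nonempty_iff_ne_empty]
    intro h
    apply hP.ne_top
    rw [← IsPrime.vanishingIdeal_zeroLocus (K := F) P, h, vanishingIdeal_empty]
  · have hle : vanishingIdeal F W₁ ⊓ vanishingIdeal F W₂ ≤ P := by
      conv_rhs => rw [← IsPrime.vanishingIdeal_zeroLocus (K := F) P]
      exact fun f hf y hy => (hW hy).elim (hf.1 y) (hf.2 y)
    rw [hP.inf_le] at hle
    refine hle.imp ?_ ?_ <;>
    · intro h
      first | rw [h₁.eq_zeroLocus] | rw [h₂.eq_zeroLocus]
      exact zeroLocus_anti_mono h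

/-- A closed set is the union of finitely many of its components. -/
theorem IsZariskiClosed.exists_finite_components [IsAlgClosed F] [Finite σ] {V : Set (σ → F)}
    (hV : IsZariskiClosed V) :
    ∃ 𝓦 : Set (Set (σ → F)), 𝓦.Finite ∧ (∀ W ∈ 𝓦, IsComponent W V) ∧ V ⊆ ⋃₀ 𝓦 := by
  -- The components come from the minimal primes over the vanishing ideal, finitely many in a
  -- noetherian ring.
  refine ⟨zeroLocus F '' (vanishingIdeal F V).minimalPrimes,
    (Ideal.finite_minimalPrimes_of_isNoetherianRing _ _).image _, ?_, fun x hx => ?_⟩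
  · rintro _ ⟨P, hP, rfl⟩
    have hPp : P.IsPrime := hP.1.1
    refine ⟨⟨isIrredClosed_zeroLocus P, ?_⟩, fun U hU hPU => ?_⟩
    · conv_rhs => rw [hV.eq_zeroLocus]
      exact zeroLocus_anti_mono hP.1.2
    · have h₁ := vanishingIdeal_anti_mono (k := F) hPU
      rw [IsPrime.vanishingIdeal_zeroLocus (K := F) P] at h₁
      have h₂ := hP.2 ⟨hU.1.isPrime_vanishingIdeal, vanishingIdeal_anti_mono hU.2⟩ h₁
      rw [hU.1.1.eq_zeroLocus]
      exact zeroLocus_anti_mono h₂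
  · obtain ⟨P, hP, hle⟩ := Ideal.exists_minimalPrimes_le
      (vanishingIdeal_anti_mono (k := F) (Set.singleton_subset_iff.2 hx))
    exact ⟨_, ⟨P, hP, rfl⟩, fun p hp => hle hp x rfl⟩

theorem IsZariskiClosed.union {W₁ W₂ : Set (σ → F)} (h₁ : IsZariskiClosed W₁)
    (h₂ : IsZariskiClosed W₂) : IsZariskiClosed (W₁ ∪ W₂) := by
  refine Set.Subset.antisymm (fun x hx => ?_) (subset_zariskiClosure _)
  by_contra hcon
  rw [Set.mem_union, not_or, h₁.eq_zeroLocus, h₂.eq_zeroLocus] at hcon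
  simp only [mem_zeroLocus_iff, not_forall] at hcon
  obtain ⟨⟨f, hf, hfx⟩, g, hg, hgx⟩ := hcon
  have := hx (f * g) fun y hy => by
    rw [map_mul, mul_eq_zero]
    exact hy.imp (hf y) (hg y)
  rw [map_mul] at this
  exact mul_ne_zero hfx hgx this

theorem IsZariskiClosed.sUnion {𝓦 : Set (Set (σ → F))} (hfin : 𝓦.Finite)
    (hcl : ∀ W ∈ 𝓦, IsZariskiClosed W) : IsZariskiClosed (⋃₀ 𝓦) := by
  induction 𝓦, hfin using Set.Finite.induction_on with
  | empty =>
    have h := isZariskiClosed_zeroLocus (F := F) (⊤ : Ideal (MvPolynomial σ F))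
    rw [zeroLocus_top] at h
    rwa [Set.sUnion_empty]
  | insert _ _ ih =>
    rw [Set.sUnion_insert]
    exact (hcl _ (Set.mem_insert _ _)).union (ih fun W hW => hcl W (Set.mem_insert_of_mem _ hW))

theorem IsIrredClosed.subset_of_subset_sUnion {Z : Set (σ → F)} (hZ : IsIrredClosed Z)
    {𝓦 : Set (Set (σ → F))} (hfin : 𝓦.Finite) (hcl : ∀ W ∈ 𝓦, IsZariskiClosed W)
    (h : Z ⊆ ⋃₀ 𝓦) : ∃ W ∈ 𝓦, Z ⊆ W := by
  induction 𝓦, hfin using Set.Finite.induction_on with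
  | empty =>
    obtain ⟨z, hz⟩ := hZ.2.1
    simpa using h hz
  | insert _ hfin ih =>
    have hcl' := fun W hW => hcl W (Set.mem_insert_of_mem _ hW)
    rw [Set.sUnion_insert] at h
    rcases hZ.2.2 _ _ (hcl _ (Set.mem_insert _ _)) (.sUnion hfin hcl') h with h | h
    · exact ⟨_, Set.mem_insert _ _, h⟩
    · obtain ⟨W, hW, hZW⟩ := ih hcl' h
      exact ⟨W, Set.mem_insert_of_mem _ hW, hZW⟩

/-- The closure of the image of `V` under a map between sets of coordinates. -/
def coordClosure (e : σ → τ) (V : Set (τ → F)) : Set (σ → F) :=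
  zariskiClosure ((fun x => x ∘ e) '' V)

theorem mem_vanishingIdeal_coordClosure {k : Type*} [Field k] [Algebra k F] (e : σ → τ)
    (V : Set (τ → F)) (p : MvPolynomial σ k) :
    p ∈ vanishingIdeal k (coordClosure e V) ↔ rename e p ∈ vanishingIdeal k V := by
  rw [coordClosure, vanishingIdeal_zariskiClosure]
  simp [aeval_rename]

theorem preimage_zeroLocus (e : σ → τ) (I : Ideal (MvPolynomial σ F)) :
    (fun x : τ → F => x ∘ e) ⁻¹' zeroLocus F I =
      zeroLocus F (Ideal.span (rename e '' (I : Set (MvPolynomial σ F)))) := by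
  ext x
  simp only [zeroLocus_span, Set.mem_preimage, mem_zeroLocus_iff, Set.forall_mem_image,
    aeval_rename, SetLike.mem_coe, Set.mem_ofPred_eq]

theorem IsZariskiClosed.preimage {W : Set (σ → F)} (hW : IsZariskiClosed W) (e : σ → τ) :
    IsZariskiClosed ((fun x : τ → F => x ∘ e) ⁻¹' W) := by
  rw [hW.eq_zeroLocus, preimage_zeroLocus]
  exact isZariskiClosed_zeroLocus _

theorem IsIrredClosed.coordClosure {W : Set (τ → F)} (hW : IsIrredClosed W) (e : σ → τ) :
    IsIrredClosed (coordClosure e W) := by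
  refine ⟨isZariskiClosed_zariskiClosure _, (hW.2.1.image _).mono (subset_zariskiClosure _),
    fun W₁ W₂ h₁ h₂ h => ?_⟩
  refine (hW.2.2 _ _ (h₁.preimage e) (h₂.preimage e) fun x hx =>
    h (subset_zariskiClosure _ ⟨x, hx, rfl⟩)).imp ?_ ?_
  · exact fun h => h₁.zariskiClosure_subset (Set.image_subset_iff.2 h)
  · exact fun h => h₂.zariskiClosure_subset (Set.image_subset_iff.2 h)

/-- The components of the closure of an image are closures of images of components. -/
theorem IsComponent.exists_eq_coordClosure [IsAlgClosed F] [Finite τ] {V : Set (τ → F)}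
    (hV : IsZariskiClosed V) {e : σ → τ} {Z : Set (σ → F)} (hZ : IsComponent Z (coordClosure e V)) :
    ∃ W, IsComponent W V ∧ Z = coordClosure e W := by
  obtain ⟨𝓦, hfin, hcomp, hcov⟩ := hV.exists_finite_components
  have hcl : ∀ Y ∈ _root_.coordClosure e '' 𝓦, IsZariskiClosed Y := by
    rintro _ ⟨W, -, rfl⟩
    exact isZariskiClosed_zariskiClosure _
  -- A finite union of closed sets is closed, so it contains the closure of the image as soon as it
  -- contains the image.
  have hsub : _root_.coordClosure e V ⊆ ⋃₀ (_root_.coordClosure e '' 𝓦) := by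
    refine (IsZariskiClosed.sUnion (hfin.image _) hcl).zariskiClosure_subset ?_
    rintro _ ⟨x, hx, rfl⟩
    obtain ⟨W, hW, hxW⟩ := hcov hx
    exact ⟨_, ⟨W, hW, rfl⟩, subset_zariskiClosure _ ⟨x, hxW, rfl⟩⟩
  obtain ⟨_, ⟨W, hW, rfl⟩, hZW⟩ :=
    hZ.1.1.subset_of_subset_sUnion (hfin.image _) hcl (hZ.1.2.trans hsub)
  refine ⟨W, hcomp W hW, hZW.antisymm (hZ.2 ⟨(hcomp W hW).1.1.coordClosure e, ?_⟩ hZW)⟩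
  exact zariskiClosure_mono (Set.image_mono (hcomp W hW).1.2)

/-! ### Definability of projections -/

variable {k : Type*} [Field k] [Algebra k F]

/-- Application of a `k`-linear functional to the coefficients of a polynomial. -/
def mapCoeff (θ : F →ₗ[k] k) (f : MvPolynomial σ F) : MvPolynomial σ k :=
  ∑ m ∈ f.support, monomial m (θ (coeff m f))

theorem coeff_mapCoeff (θ : F →ₗ[k] k) (f : MvPolynomial σ F) (m : σ →₀ ℕ) :
    coeff m (mapCoeff θ f) = θ (coeff m f) := by
  classical
  simp only [mapCoeff, coeff_sum, coeff_monomial, Finset.sum_ite_eq']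
  split_ifs with h
  · rfl
  · rw [notMem_support_iff.1 h, map_zero]

theorem mapCoeff_add (θ : F →ₗ[k] k) (f g : MvPolynomial σ F) :
    mapCoeff θ (f + g) = mapCoeff θ f + mapCoeff θ g := by
  ext m; simp [coeff_mapCoeff]

/-- Linearity of `θ` over `k` makes `mapCoeff θ` linear over `k[X]`; this is why it carries an
extended ideal back into the original one. -/
theorem mapCoeff_mul_map (θ : F →ₗ[k] k) (f : MvPolynomial σ F) (p : MvPolynomial σ k) :
    mapCoeff θ (f * map (algebraMap k F) p) = mapCoeff θ f * p := by
  classical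
  ext m
  simp only [coeff_mapCoeff, coeff_mul, coeff_map, map_sum]
  refine Finset.sum_congr rfl fun y _ => ?_
  rw [mul_comm, ← Algebra.smul_def, map_smul, smul_eq_mul, mul_comm]

theorem mapCoeff_rename (θ : F →ₗ[k] k) {e : σ → τ} (he : Function.Injective e)
    (f : MvPolynomial σ F) : mapCoeff θ (rename e f) = rename e (mapCoeff θ f) := by
  ext m
  rw [coeff_mapCoeff]
  by_cases h : ∃ u : σ →₀ ℕ, u.mapDomain e = m
  · obtain ⟨u, rfl⟩ := h
    rw [coeff_rename_mapDomain _ he, coeff_rename_mapDomain _ he, coeff_mapCoeff]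
  · push Not at h
    rw [coeff_rename_eq_zero _ _ _ fun u hu => absurd hu (h u),
      coeff_rename_eq_zero _ _ _ fun u hu => absurd hu (h u), map_zero]

theorem mapCoeff_mem (θ : F →ₗ[k] k) {I : Ideal (MvPolynomial σ k)} {f : MvPolynomial σ F}
    (hf : f ∈ I.map (map (algebraMap k F))) : mapCoeff θ f ∈ I := by
  -- The multiplier `a` has coefficients in `F`, over which `mapCoeff θ` is not linear; carrying it
  -- along makes the induction on the span go through.
  suffices h : ∀ a, mapCoeff θ (a * f) ∈ I by simpa using h 1
  induction hf using Submodule.span_induction with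
  | mem f hf =>
    obtain ⟨p, hp, rfl⟩ := hf
    intro a
    rw [mapCoeff_mul_map]
    exact I.mul_mem_left _ hp
  | zero => simp [mapCoeff]
  | add f g _ _ hf hg =>
    intro a
    rw [mul_add, mapCoeff_add]
    exact I.add_mem (hf a) (hg a)
  | smul b f _ hf =>
    intro a
    rw [smul_eq_mul, ← mul_assoc]
    exact hf _

/-- Expanding the coefficients of `f` in a `k`-basis of `F` writes `f` as an `F`-combination of the
polynomials `mapCoeff θ f`, with `θ` a coordinate functional. -/
theorem aeval_eq_zero_of_mapCoeff {f : MvPolynomial σ F} {y : σ → F}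
    (h : ∀ θ : F →ₗ[k] k, aeval y (mapCoeff θ f) = 0) : aeval y f = 0 := by
  classical
  let b := Module.Free.chooseBasis k F
  let T := f.support.biUnion fun m => (b.repr (coeff m f)).support
  have hf : f = ∑ i ∈ T, C (b i) * map (algebraMap k F) (mapCoeff (b.coord i) f) := by
    ext m
    simp only [coeff_sum, coeff_C_mul, coeff_map, coeff_mapCoeff, Module.Basis.coord_apply]
    have := b.linearCombination_repr (coeff m f)
    rw [Finsupp.linearCombination_apply, Finsupp.sum_of_support_subset _ (s := T)] at this
    · refine this.symm.trans (Finset.sum_congr rfl fun i _ => ?_)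
      rw [Algebra.smul_def, mul_comm]
    · by_cases hm : m ∈ f.support
      · exact Finset.subset_biUnion_of_mem (fun m => (b.repr (coeff m f)).support) hm
      · rw [notMem_support_iff.1 hm]; simp
    · simp
  rw [hf, map_sum]
  refine Finset.sum_eq_zero fun i _ => ?_
  rw [map_mul, aeval_map_algebraMap, h, mul_zero]

/-- If `g` vanishes on the image, some power `g ^ N`, renamed, lies in the extension of `I` to `F`.
Every functional `θ` sends it into `I`, so `mapCoeff θ (g ^ N)` is an equation over `k` of the
closure. A zero `y` of all such equations is a zero of `g ^ N`, hence of `g`. -/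
theorem coordClosure_zeroLocus [IsAlgClosed F] [Finite τ] {e : σ → τ} (he : Function.Injective e)
    (I : Ideal (MvPolynomial τ k)) :
    coordClosure e (zeroLocus F I) =
      zeroLocus F (vanishingIdeal k (coordClosure e (zeroLocus F I))) := by
  refine Set.Subset.antisymm (zeroLocus_vanishingIdeal_le _) fun y hy => ?_
  rw [coordClosure, zariskiClosure]
  intro g hg
  rw [← vanishingIdeal_zariskiClosure, ← coordClosure, mem_vanishingIdeal_coordClosure] at hg
  have hI : zeroLocus F I = zeroLocus F (I.map (map (algebraMap k F))) := by
    rw [Ideal.map, zeroLocus_span]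
    ext x
    simp only [mem_zeroLocus_iff, Set.mem_ofPred_eq, Set.forall_mem_image, SetLike.mem_coe,
      aeval_map_algebraMap]
  rw [hI, vanishingIdeal_zeroLocus_eq_radical] at hg
  obtain ⟨N, hN⟩ := hg
  rw [← map_pow] at hN
  have h0 : aeval y (g ^ N) = 0 := aeval_eq_zero_of_mapCoeff fun θ => hy _ <| by
    rw [mem_vanishingIdeal_coordClosure, ← mapCoeff_rename θ he]
    exact le_vanishingIdeal_zeroLocus I (mapCoeff_mem θ hN)
  rw [map_pow] at h0
  exact eq_zero_of_pow_eq_zero h0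

end Zariski

/-! ### The projection of `V` and its generic coordinate ring -/

section Projection

open MvPolynomial

variable {k : Type*} [Field k] {t r s : ℕ} (hsr : s ≤ r)
  {V : Set (Fin t ⊕ Fin r → AlgebraicClosure k)}

/-- The inclusion of the sets of coordinates. -/
abbrev coordIncl (t : ℕ) {r s : ℕ} (hsr : s ≤ r) : Fin t ⊕ Fin s → Fin t ⊕ Fin r :=
  Sum.map id (Fin.castLE hsr)

theorem coordIncl_injective : Function.Injective (coordIncl t hsr) :=
  Sum.map_injective.2 ⟨Function.injective_id, Fin.castLE_injective hsr⟩

theorem rename_coordIncl_rename_inl (f : MvPolynomial (Fin t) k) :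
    rename (coordIncl t hsr) (rename Sum.inl f) = rename Sum.inl f := by
  rw [rename_rename]; rfl

theorem rename_inl_mem_vanishingIdeal_projClosure {f : MvPolynomial (Fin t) k} :
    rename Sum.inl f ∈ vanishingIdeal k (projClosure hsr V) ↔
      rename Sum.inl f ∈ vanishingIdeal k V := by
  rw [← rename_coordIncl_rename_inl hsr]
  exact mem_vanishingIdeal_coordClosure _ _ _

/-- The coordinate ring of the projection embeds in that of `W`, which gives `≤ t`. The free
variables remain independent on it, first over `k` and then over its algebraic closure, which gives
`≥ t`. -/
theorem varDim_projClosure {W : Set (Fin t ⊕ Fin r → AlgebraicClosure k)} (hW : IsIrredClosed W)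
    (hdim : varDim W = (t : Cardinal)) (hfree : ∀ f : MvPolynomial (Fin t) k,
      rename Sum.inl f ∈ (vanishingIdeal k W : Ideal (MvPolynomial (Fin t ⊕ Fin r) k)) → f = 0) :
    varDim (projClosure hsr W) = (t : Cardinal) := by
  have hZ : IsIrredClosed (projClosure hsr W) := hW.coordClosure _
  have hprime := hZ.isPrime_vanishingIdeal
  refine le_antisymm ?_ ?_
  · rw [← hdim]
    let φ := Ideal.quotientMapₐ (vanishingIdeal (AlgebraicClosure k) W)
      (rename (R := AlgebraicClosure k) (coordIncl t hsr))
      (fun p hp => (mem_vanishingIdeal_coordClosure _ _ _).1 hp :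
        vanishingIdeal (AlgebraicClosure k) (projClosure hsr W) ≤ _)
    have hφ : Function.Injective φ := Ideal.quotientMap_injective'
      (I := vanishingIdeal (AlgebraicClosure k) W)
      (f := (rename (R := AlgebraicClosure k) (coordIncl t hsr)).toRingHom)
      (H := fun p hp => (mem_vanishingIdeal_coordClosure _ _ _).1 hp)
      fun p hp => (mem_vanishingIdeal_coordClosure _ _ _).2 hp
    exact trdeg_le_of_injective φ hφ
  · let x : Fin t → MvPolynomial (Fin t ⊕ Fin s) (AlgebraicClosure k) ⧸
        vanishingIdeal (AlgebraicClosure k) (projClosure hsr W) :=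
      fun i => Ideal.Quotient.mk _ (X (Sum.inl i))
    have hev : ∀ f : MvPolynomial (Fin t) k, aeval x f = Ideal.Quotient.mk
        (vanishingIdeal (AlgebraicClosure k) (projClosure hsr W))
        (MvPolynomial.map (algebraMap k (AlgebraicClosure k)) (rename Sum.inl f)) := by
      intro f
      induction f using MvPolynomial.induction_on with
      | C a => rw [aeval_C, rename_C, map_C]; rfl
      | add f g hf hg => simp only [map_add, hf, hg]
      | mul_X f i hf => simp only [map_mul, hf, aeval_X, rename_X, map_X, x]
    have hx : AlgebraicIndependent k x := by
      rw [algebraicIndependent_iff]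
      intro f hf
      rw [hev, Ideal.Quotient.eq_zero_iff_mem] at hf
      refine hfree f ((rename_inl_mem_vanishingIdeal_projClosure hsr).1 fun z hz => ?_)
      have := hf z hz
      rwa [aeval_map_algebraMap] at this
    have := (hx.extendScalars (AlgebraicClosure k)).lift_cardinalMk_le_trdeg
    simpa [varDim] using this

theorem IsFreeEquidim.projClosure (hV : IsFreeEquidim k V) :
    IsFreeEquidim k (projClosure hsr V) := by
  obtain ⟨⟨I, rfl⟩, hne, hdim, hfree⟩ := hV
  have hcomp : ∀ Z, IsComponent Z (_root_.projClosure hsr (zeroLocus (AlgebraicClosure k) I)) →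
      ∃ W, IsComponent W (zeroLocus (AlgebraicClosure k) I) ∧ Z = _root_.projClosure hsr W :=
    fun Z hZ => IsComponent.exists_eq_coordClosure (isZariskiClosed_zeroLocus I) hZ
  refine ⟨⟨_, coordClosure_zeroLocus (coordIncl_injective hsr) I⟩,
    (hne.image _).mono (subset_zariskiClosure _), fun Z hZ => ?_, fun Z hZ f hf => ?_⟩
  · obtain ⟨W, hW, rfl⟩ := hcomp Z hZ
    exact varDim_projClosure hsr hW.1.1 (hdim W hW) (hfree W hW)
  · obtain ⟨W, hW, rfl⟩ := hcomp Z hZ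
    exact hfree W hW f ((rename_inl_mem_vanishingIdeal_projClosure hsr).1 hf)

/-! ### The generic coordinate ring -/

theorem CoordRing.algebraMap_apply (V : Set (Fin t ⊕ Fin r → AlgebraicClosure k))
    (f : MvPolynomial (Fin t) k) :
    algebraMap (MvPolynomial (Fin t) k) (CoordRing k V) f = CoordRing.mk k V (rename Sum.inl f) :=
  rfl

theorem CoordRing.mk_eq_zero (V : Set (Fin t ⊕ Fin r → AlgebraicClosure k))
    (f : MvPolynomial (Fin t ⊕ Fin r) k) :
    CoordRing.mk k V f = 0 ↔ f ∈ vanishingIdeal k V :=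
  Ideal.Quotient.eq_zero_iff_mem

/-- Freeness on one component makes `k[X₁, …, X_t] → k[V]` injective. Flatness of `𝕂` preserves
this, so `1` cannot become zero in the tensor product. -/
theorem IsFreeEquidim.nontrivial_genericRing (hV : IsFreeEquidim k V) :
    Nontrivial (GenericRing k V) := by
  have hinj : Function.Injective (Algebra.linearMap (MvPolynomial (Fin t) k) (CoordRing k V)) := by
    rw [injective_iff_map_eq_zero]
    intro f hf
    rw [Algebra.linearMap_apply, CoordRing.algebraMap_apply, CoordRing.mk_eq_zero] at hf
    obtain ⟨I, hI⟩ := hV.definable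
    obtain ⟨𝓦, -, hcomp, hcov⟩ :=
      (hI ▸ isZariskiClosed_zeroLocus I : IsZariskiClosed V).exists_finite_components
    obtain ⟨z, hz⟩ := hV.nonempty
    obtain ⟨W, hW, -⟩ := hcov hz
    exact hV.free W (hcomp W hW) f fun y hy => hf y ((hcomp W hW).1.2 hy)
  have := Module.Flat.lTensor_preserves_injective_linearMap (M := RatField k t) _ hinj
  refine ⟨(1 : RatField k t) ⊗ₜ[MvPolynomial (Fin t) k] (1 : CoordRing k V), 0, fun h => ?_⟩
  have h1 : (1 : RatField k t) ⊗ₜ[MvPolynomial (Fin t) k] (1 : MvPolynomial (Fin t) k) = 0 := by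
    apply this
    rw [LinearMap.lTensor_tmul, Algebra.linearMap_apply, map_one, h, map_zero]
  have h2 := congrArg (TensorProduct.rid (MvPolynomial (Fin t) k) (RatField k t)) h1
  simp at h2

/-- The inclusion of coordinate rings induced by the projection. -/
def coordRingMap (V : Set (Fin t ⊕ Fin r → AlgebraicClosure k)) :
    CoordRing k (projClosure hsr V) →ₐ[MvPolynomial (Fin t) k] CoordRing k V where
  toRingHom := Ideal.quotientMap (vanishingIdeal k V) (rename (R := k) (coordIncl t hsr)).toRingHom
    fun _ hp => (mem_vanishingIdeal_coordClosure _ _ _).1 hp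
  commutes' f := congrArg (CoordRing.mk k V) (rename_coordIncl_rename_inl hsr f)

theorem coordRingMap_injective (V : Set (Fin t ⊕ Fin r → AlgebraicClosure k)) :
    Function.Injective (coordRingMap hsr V) :=
  Ideal.quotientMap_injective' (I := vanishingIdeal k V)
    (f := (rename (R := k) (coordIncl t hsr)).toRingHom)
    (H := fun _ hp => (mem_vanishingIdeal_coordClosure _ _ _).1 hp)
    fun _ hp => (mem_vanishingIdeal_coordClosure _ _ _).2 hp

/-- The inclusion of generic coordinate rings induced by the projection. -/
def genericRingMap (V : Set (Fin t ⊕ Fin r → AlgebraicClosure k)) :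
    GenericRing k (projClosure hsr V) →ₐ[RatField k t] GenericRing k V :=
  Algebra.TensorProduct.map (AlgHom.id _ _) (coordRingMap hsr V)

theorem genericRingMap_injective (V : Set (Fin t ⊕ Fin r → AlgebraicClosure k)) :
    Function.Injective (genericRingMap hsr V) :=
  Module.Flat.lTensor_preserves_injective_linearMap (M := RatField k t)
    (coordRingMap hsr V).toLinearMap (coordRingMap_injective hsr V)

theorem genericRingMap_cls (V : Set (Fin t ⊕ Fin r → AlgebraicClosure k))
    (f : MvPolynomial (Fin t ⊕ Fin s) k) :
    genericRingMap hsr V (GenericRing.cls k _ f) =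
      GenericRing.cls k V (rename (coordIncl t hsr) f) := rfl

theorem genericRingMap_cls_X (V : Set (Fin t ⊕ Fin r → AlgebraicClosure k)) (j : Fin s) :
    genericRingMap hsr V (GenericRing.cls k _ (X (Sum.inr j))) =
      GenericRing.cls k V (X (Sum.inr (Fin.castLE hsr j))) := by
  rw [genericRingMap_cls, rename_X]; rfl

theorem cls_linForm (V : Set (Fin t ⊕ Fin r → AlgebraicClosure k)) (a : Fin r → k) :
    GenericRing.cls k V (linForm t a) = ∑ j, algebraMap k (RatField k t) (a j) •
      GenericRing.cls k V (X (Sum.inr j)) := by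
  simp only [GenericRing.cls, linForm, map_sum, TensorProduct.tmul_sum, map_mul]
  refine Finset.sum_congr rfl fun j _ => ?_
  have : CoordRing.mk k V (C (a j)) = algebraMap (MvPolynomial (Fin t) k) _ (C (a j)) := by
    rw [CoordRing.algebraMap_apply, rename_C]
  rw [this, ← Algebra.smul_def, TensorProduct.tmul_smul, TensorProduct.smul_tmul',
    TensorProduct.smul_tmul', Algebra.smul_def, ← MvPolynomial.algebraMap_eq,
    ← IsScalarTower.algebraMap_apply k (MvPolynomial (Fin t) k) (RatField k t), smul_eq_mul]

end Projection

/-! ## The linear systems of the algorithm -/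

section LinearSystems

open Polynomial

variable {K A : Type*} [Field K] [CommRing A] [Algebra K A] {D : ℕ}

theorem degree_finPoly_lt (T : Fin D → K) : (finPoly D T).degree < D :=
  (degree_lt_iff_coeff_zero _ _).2 fun _ hn => coeff_finPoly_eq_zero T hn

theorem finPoly_coeffVec {f : K[X]} (hf : f.degree < D) : finPoly D (coeffVec D f) = f := by
  ext n
  by_cases hn : n < D
  · rw [coeff_finPoly _ hn]; rfl
  · rw [coeff_finPoly_eq_zero _ (not_lt.1 hn),
      (degree_lt_iff_coeff_zero _ _).1 hf n (not_lt.1 hn)]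

theorem powComb_coeffVec {f : K[X]} (hf : f.degree < D) (y : A) :
    powComb D y (coeffVec D f) = aeval y f := by
  rw [powComb_apply, finPoly_coeffVec hf]

theorem finPoly_injective : Function.Injective (finPoly (F := K) D) := fun S T h => by
  ext i
  have := congrArg (fun f => f.coeff (i : ℕ)) h
  simpa only [coeff_finPoly _ i.2] using this

theorem eq_of_aeval_eq_of_degree_lt {y : A} {f g : K[X]} (hf : f.degree < (minpoly K y).degree)
    (hg : g.degree < (minpoly K y).degree) (h : aeval y f = aeval y g) : f = g := by
  by_contra hne
  have h0 : aeval y (f - g) = 0 := by rw [map_sub, h, sub_self]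
  exact ((degree_sub_le f g).trans_lt (max_lt hf hg)).not_ge
    (minpoly.degree_le_of_ne_zero K y (sub_ne_zero.2 hne) h0)

theorem powComb_injective {y : A} (hy : IsIntegral K y) (hD : D ≤ (minpoly K y).natDegree) :
    Function.Injective (powComb (F := K) D y) := fun S T h => by
  have hlt : ∀ U : Fin D → K, (finPoly D U).degree < (minpoly K y).degree := fun U =>
    (degree_finPoly_lt U).trans_le <| by
      rw [degree_eq_natDegree (minpoly.ne_zero hy)]; exact_mod_cast hD
  exact finPoly_injective (eq_of_aeval_eq_of_degree_lt (hlt S) (hlt T) h)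

/-- Reduce any polynomial expression in `y` modulo the minimal polynomial. -/
theorem mem_range_powComb {y : A} (hy : IsIntegral K y) (hD : (minpoly K y).natDegree ≤ D) {z : A}
    (hz : z ∈ Algebra.adjoin K {y}) : ∃ T, powComb (F := K) D y T = z := by
  rw [Algebra.adjoin_singleton_eq_range_aeval] at hz
  obtain ⟨f, rfl⟩ := hz
  refine ⟨coeffVec D (f %ₘ minpoly K y), ?_⟩
  rw [powComb_coeffVec, aeval_modByMonic_eq_self_of_root (minpoly.aeval K y)]
  · rfl
  · refine (degree_modByMonic_lt _ (minpoly.monic hy)).trans_le ?_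
    rw [degree_eq_natDegree (minpoly.ne_zero hy)]; exact_mod_cast hD

theorem range_powComb {y : A} (hy : IsIntegral K y) (hD : (minpoly K y).natDegree ≤ D) :
    LinearMap.range (powComb (F := K) D y) = Subalgebra.toSubmodule (Algebra.adjoin K {y}) := by
  refine le_antisymm ?_ fun z hz => mem_range_powComb hy hD hz
  rintro _ ⟨T, rfl⟩
  exact aeval_mem_adjoin_singleton K y

theorem eq_X_pow_sub_finPoly {f : K[X]} (hf : f.Monic) :
    f = X ^ f.natDegree - finPoly f.natDegree fun i => -f.coeff i := by
  conv_lhs => rw [hf.as_sum]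
  rw [finPoly_apply, Finset.sum_range, sub_eq_add_neg, ← Finset.sum_neg_distrib]
  simp [C_mul_X_pow_eq_monomial]

theorem finPoly_eq_sum_C_mul (T : Fin D → K) :
    finPoly D T = ∑ i, C (T i) * X ^ (i : ℕ) := by
  rw [finPoly_apply]
  simp only [C_mul_X_pow_eq_monomial]

theorem pow_add_powComb_coeffVec {f : K[X]} (hf : f.Monic) (hD : f.natDegree = D) (y : A) :
    y ^ D + powComb D y (coeffVec D f) = aeval y f := by
  subst hD
  conv_rhs => rw [eq_X_pow_sub_finPoly hf]
  have : (fun i : Fin f.natDegree => -f.coeff i) = -coeffVec f.natDegree f := rfl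
  rw [this, map_neg, sub_neg_eq_add, map_add, map_pow, aeval_X, powComb_apply]

variable {q p : K[X]}

theorem degree_powMod_lt (hq : q.Monic) (hq0 : 0 < q.natDegree) (hp : p.degree < q.degree) :
    ∀ i, (powMod q p i).degree < q.degree
  | 0 => by rw [powMod, degree_one, degree_eq_natDegree hq.ne_zero]; exact_mod_cast hq0
  | 1 => hp
  | _ + 2 => degree_modByMonic_lt _ hq

theorem aeval_powMod {y : A} (hy : aeval y q = 0) : ∀ i, aeval y (powMod q p i) = aeval y p ^ i
  | 0 => by rw [powMod, map_one, pow_zero]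
  | 1 => by rw [powMod, pow_one]
  | i + 2 => by
    rw [powMod, aeval_modByMonic_eq_self_of_root hy, map_mul, aeval_powMod hy (i + 1),
      ← pow_succ']

theorem powComb_powMod {y : A} (hq : q.Monic) (hD : q.natDegree = D) (hD0 : 0 < D)
    (hp : p.degree < q.degree) (hy : aeval y q = 0) (i : ℕ) :
    powComb D y (coeffVec D (powMod q p i)) = aeval y p ^ i := by
  rw [powComb_coeffVec, aeval_powMod hy]
  have := degree_powMod_lt hq (hD ▸ hD0) hp i
  rwa [degree_eq_natDegree hq.ne_zero, hD] at this

/-- Under evaluation at `y`, the matrix becomes the map sending `a` to `∑ aⱼ μ^j`, where `μ` is the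
value of `p`. Solving the systems is thus a question about powers of `μ`. -/
theorem powComb_mulVec {y : A} (hq : q.Monic) (hD : q.natDegree = D) (hD0 : 0 < D)
    (hp : p.degree < q.degree) (hy : aeval y q = 0) {m : ℕ} (a : Fin m → K) :
    powComb D y ((powMatrix D m q p).mulVec a) = powComb m (aeval y p) a := by
  have : (powMatrix D m q p).mulVec a = ∑ j, a j • coeffVec D (powMod q p j) := by
    ext i
    simp [Matrix.mulVec, dotProduct, powMatrix, mul_comm]
  rw [this, map_sum, powComb_eq_sum]
  simp only [map_smul, powComb_powMod hq hD hD0 hp hy]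

/-- Evaluation at `y` is injective and so preserves the rank. The image of the column space is
`K[μ]`, because `D` is at least the degree of `μ`. -/
theorem deltaRank_eq {y : A} (hq : q = minpoly K y) (hint : IsIntegral K y)
    (hD : q.natDegree = D) (hD0 : 0 < D)
    (hp : p.degree < q.degree) (hμ : IsIntegral K (aeval y p))
    (hd : (minpoly K (aeval y p)).natDegree ≤ D) :
    deltaRank D q p = (minpoly K (aeval y p)).natDegree := by
  have hqm : q.Monic := hq ▸ minpoly.monic hint
  have hy : aeval y q = 0 := hq ▸ minpoly.aeval K y
  have hinj := powComb_injective hint (D := D) (by rw [← hq, hD])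
  have hcomp : powComb D y ∘ₗ (powMatrix D D q p).mulVecLin = powComb D (aeval y p) :=
    LinearMap.ext fun a => powComb_mulVec hqm hD hD0 hp hy a
  rw [deltaRank, Matrix.rank, (Submodule.equivMapOfInjective _ hinj _).finrank_eq,
    ← LinearMap.range_comp, hcomp,
    range_powComb hμ hd, ← range_powComb hμ le_rfl,
    LinearMap.finrank_range_of_inj (powComb_injective hμ le_rfl)]
  simp

end LinearSystems

/-! ### The geometric resolution of the projection and the main theorem -/

section Main

open Polynomial

variable {k : Type*} [Field k] {t r s D : ℕ}

/-- The output conditions of the algorithm, for a known value of `δ`. -/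
theorem isGeomResProjOutput_iff {hsr : s ≤ r} {q : (RatField k t)[X]}
    {w : Fin r → (RatField k t)[X]} {mu : Fin s → k} {d : ℕ}
    (hd : deltaRank D q (pMu hsr w mu) = d) {qmu : (RatField k t)[X]}
    {v : Fin s → (RatField k t)[X]} :
    IsGeomResProjOutput hsr D q w mu qmu v ↔
      ∃ (a : Fin d → RatField k t) (b : Fin s → Fin d → RatField k t),
        (powMatrix D d q (pMu hsr w mu)).mulVec a = coeffVec D (powMod q (pMu hsr w mu) d) ∧
        (∀ j, (powMatrix D d q (pMu hsr w mu)).mulVec (b j) = coeffVec D (w (Fin.castLE hsr j))) ∧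
        qmu = X ^ d - finPoly d a ∧ ∀ j, v j = finPoly d (b j) := by
  subst hd
  simp only [finPoly_eq_sum_C_mul]
  rfl

variable {V : Set (Fin t ⊕ Fin r → AlgebraicClosure k)} {lam : Fin r → k}
  {q : (RatField k t)[X]} {w : Fin r → (RatField k t)[X]}

theorem IsGeomRes.degree_pMu_lt (h : IsGeomRes k V lam q w) (hq : q ≠ 0) (hsr : s ≤ r)
    (mu : Fin s → k) : (pMu hsr w mu).degree < q.degree := by
  rw [pMu, degree_eq_natDegree hq]
  refine (degree_lt_iff_coeff_zero _ _).2 fun n hn => ?_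
  rw [finsetSum_coeff]
  refine Finset.sum_eq_zero fun j _ => ?_
  have := h.degree_lt (Fin.castLE hsr j)
  rw [degree_eq_natDegree hq] at this
  rw [coeff_C_mul, (degree_lt_iff_coeff_zero _ _).1 this n hn, mul_zero]

theorem IsGeomRes.aeval_pMu (h : IsGeomRes k V lam q w) (hsr : s ≤ r) (mu : Fin s → k) :
    aeval (GenericRing.cls k V (linForm t lam)) (pMu hsr w mu) =
      genericRingMap hsr V (GenericRing.cls k _ (linForm t mu)) := by
  rw [cls_linForm (projClosure hsr V), map_sum, pMu, map_sum]
  refine Finset.sum_congr rfl fun j _ => ?_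
  rw [map_mul, aeval_C, h.coord, map_smul, genericRingMap_cls_X]
  exact (Algebra.smul_def _ _).symm

end Main

theorem mainTheorem7 (Ω : ℝ) (hΩ : 3 ≤ Ω) :
    ∃ (C : ℝ) (A : ∀ t r s D n : ℕ, ResCode (Fin n) t r D →
        CompTree (Fin n ⊕ Fin s) t (ProjLeaf (Fin n ⊕ Fin s) t s D)),
      ∀ (k : Type*) [Field k] [CharZero k] (t r s : ℕ) (_ : 0 < s) (hsr : s ≤ r)
        (V : Set (Fin t ⊕ Fin r → AlgebraicClosure k)) (_ : IsFreeEquidim k V)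
        (D : ℕ) (_ : D = Module.finrank (RatField k t) (GenericRing k V))
        (lam : Fin r → k) (q : Polynomial (RatField k t)) (w : Fin r → Polynomial (RatField k t))
        (_ : IsGeomRes k V lam q w)
        (mu : Fin s → k) (_ : IsPrimitive k (projClosure hsr V) mu)
        (n : ℕ) (c : Fin n → k) (E : ResCode (Fin n) t r D) (_ : E.Encodes c q w),
        -- the variety to be described satisfies the standing conditions
        IsFreeEquidim k (projClosure hsr V) ∧
        -- worst-case number of operations and comparisons in `k`
        ((A t r s D n E).cost : ℝ) ≤
          C * ((E.prog.length : ℝ) + (D : ℝ) ^ Ω + (D : ℝ) ^ 2 * (s : ℝ)) ∧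
        ∃ (qmu : Polynomial (RatField k t)) (v : Fin s → Polynomial (RatField k t)),
          -- the steps of the algorithm can be carried out in exactly one way ...
          IsGeomResProjOutput hsr D q w mu qmu v ∧
          (∀ qmu' v', IsGeomResProjOutput hsr D q w mu qmu' v' → qmu' = qmu ∧ v' = v) ∧
          -- ... and yield the geometric resolution of the projection
          IsGeomRes k (projClosure hsr V) mu qmu v ∧
          -- for a random point `x` off a hypersurface, the program finds `δ` and an slp
          -- for the coefficients of all `p_{μ^i}` and of `(q_μ, v)`
          ∃ H : MvPolynomial (Fin t) k, H ≠ 0 ∧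
            ∀ x : Fin t → k, MvPolynomial.eval x H ≠ 0 →
              ∃ (l : List k) (S : ProjLeaf (Fin n ⊕ Fin s) t s D) (b : Fin S.m → k),
                (A t r s D n E).run (Sum.elim c mu) x [] = some (l, S) ∧
                (∀ i, (S.scalars i).eval (Sum.elim c mu) x l = some (b i)) ∧
                S.δ = deltaRank D q (pMu hsr w mu) ∧
                S.code.Encodes b qmu v ∧
                (∃ l', S.code.prog.runGeneric b = some l' ∧
                  ∀ (i : Fin (D + 1)) (h : Fin D), (S.pow i h).HasValue b l'
                    ((powMod q (pMu hsr w mu) i).coeff h)) ∧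
                (S.code.prog.length : ℝ) ≤
                  C * ((E.prog.length : ℝ) + (D : ℝ) ^ Ω + (D : ℝ) ^ 2 * (s : ℝ)) := by
  -- The cost bound has coefficients `1`, `26` and `8`; the largest one serves for all three terms.
  refine ⟨26, geomResProjTree, ?_⟩
  intro k _ _ t r s hs hsr V hV D hDfin lam q w hres mu hmu n c E hE
  have hV' := hV.projClosure hsr
  obtain ⟨hqm, hqD, hwD, l₀, hl₀, hqE, hwE⟩ := hE
  have hnt := hV.nontrivial_genericRing
  set y := GenericRing.cls k V (linForm t lam) with hy
  set ν := GenericRing.cls k (projClosure hsr V) (linForm t mu) with hν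
  set ι := genericRingMap hsr V with hι
  have hιinj : Function.Injective ι := genericRingMap_injective hsr V
  -- the algebra of `V`
  have hqy : q = minpoly (RatField k t) y := hres.minpoly_eq
  have hyint : IsIntegral (RatField k t) y := by
    -- The encoded `q` is monic, hence nonzero, so `λ` is integral. Its degree is then positive, and
    -- finite dimension over `𝕂` follows from `D > 0`.
    rw [← minpoly.ne_zero_iff, ← hqy]; exact hqm.ne_zero
  have hy0 : Polynomial.aeval y q = 0 := hqy ▸ minpoly.aeval _ y
  have hD0 : 0 < D := by
    rw [← hqD, hqy]; exact minpoly.natDegree_pos hyint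
  have hfin : Module.Finite (RatField k t) (GenericRing k V) :=
    Module.finite_of_finrank_pos (hDfin ▸ hD0)
  have hinj : Function.Injective (powComb (F := RatField k t) D y) :=
    powComb_injective hyint (by rw [← hqy, hqD])
  have hpdeg : (pMu hsr w mu).degree < q.degree := hres.degree_pMu_lt hqm.ne_zero hsr mu
  have hpν : Polynomial.aeval y (pMu hsr w mu) = ι ν := hres.aeval_pMu hsr mu
  -- the algebra of the projection
  have hμint : IsIntegral (RatField k t) (ι ν) := Algebra.IsIntegral.isIntegral _
  have hmin : minpoly (RatField k t) (ι ν) = minpoly (RatField k t) ν :=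
    minpoly.algHom_eq ι hιinj ν
  have hνint : IsIntegral (RatField k t) ν := by
    rw [← minpoly.ne_zero_iff, ← hmin]; exact minpoly.ne_zero hμint
  obtain ⟨d, hd⟩ : ∃ d, d = (minpoly (RatField k t) ν).natDegree := ⟨_, rfl⟩
  have hdD : d ≤ D := by
    rw [hd, ← hmin, hDfin]; exact minpoly.natDegree_le _
  have hδ : deltaRank D q (pMu hsr w mu) = d := by
    rw [hd, ← hmin, ← hpν]
    refine deltaRank_eq hqy hyint hqD hD0 hpdeg (hpν ▸ hμint) ?_
    rw [hpν, hmin, ← hd]; exact hdD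
  have hνm := minpoly.monic hνint
  have hνdeg : (minpoly (RatField k t) ν).degree = d := by
    rw [Polynomial.degree_eq_natDegree hνm.ne_zero, hd]
  have hμinj : Function.Injective (powComb (F := RatField k t) d (ι ν)) :=
    powComb_injective hμint (by rw [hmin, hd])
  -- Since `mu` is primitive, each coordinate is a polynomial in `ν` of degree below `d`. These
  -- coefficients will be the solutions `b j`.
  have hcoord : ∀ j : Fin s, ∃ T, powComb (F := RatField k t) d ν T =
      GenericRing.cls k _ (MvPolynomial.X (Sum.inr j)) := fun j =>
    mem_range_powComb hνint hd.ge (hmu ▸ Algebra.mem_top)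
  choose T hT using hcoord
  have hιpow : ∀ {m : ℕ} (S : Fin m → RatField k t), powComb m (ι ν) S = ι (powComb m ν S) :=
    fun S => by rw [powComb_apply, powComb_apply, Polynomial.aeval_algHom_apply]
  have hwj : ∀ j, powComb D y (coeffVec D (w j)) =
      GenericRing.cls k V (MvPolynomial.X (Sum.inr j)) := fun j => by
    rw [powComb_coeffVec (hwD j), hy, hres.coord]
  have hmulVec : ∀ a : Fin d → RatField k t,
      powComb D y ((powMatrix D d q (pMu hsr w mu)).mulVec a) = powComb d (ι ν) a := fun a => by
    rw [powComb_mulVec hqm hqD hD0 hpdeg hy0, hpν]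
  have hpow : ∀ i, powComb D y (coeffVec D (powMod q (pMu hsr w mu) i)) = ι ν ^ i := fun i => by
    rw [powComb_powMod hqm hqD hD0 hpdeg hy0, hpν]
  have hwT : ∀ j, powComb d (ι ν) (T j) =
      powComb D y (coeffVec D (w (Fin.castLE hsr j))) := fun j => by
    rw [hιpow, hT, hwj, hι, genericRingMap_cls_X]
  -- the solutions of the linear systems
  let a : Fin d → RatField k t := fun i => -(minpoly (RatField k t) ν).coeff i
  have hqa : minpoly (RatField k t) ν = Polynomial.X ^ d - finPoly d a := by
    have := eq_X_pow_sub_finPoly hνm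
    rw [← hd] at this
    exact this
  have ha : powComb d (ι ν) a = ι ν ^ d := by
    have := minpoly.aeval (RatField k t) (ι ν)
    rw [hmin, hqa, map_sub, map_pow, Polynomial.aeval_X, sub_eq_zero] at this
    exact this.symm
  have hcost : ((geomResProjTree t r s D n E).cost : ℝ) ≤
      26 * ((E.prog.length : ℝ) + (D : ℝ) ^ Ω + (D : ℝ) ^ 2 * (s : ℝ)) := by
    have h₁ : ((geomResProjTree t r s D n E).cost : ℝ) ≤
        (E.prog.length : ℝ) + 26 * (D : ℝ) ^ 3 + 8 * ((D : ℝ) ^ 2 * s) := by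
      exact_mod_cast cost_geomResProjTree_le (s := s) E hD0
    have h₂ : (D : ℝ) ^ 3 ≤ (D : ℝ) ^ Ω := by
      rw [← Real.rpow_natCast]
      -- Monotonicity in the exponent requires base at least `1`, that is, `D > 0`.
      exact Real.rpow_le_rpow_of_exponent_le (by exact_mod_cast hD0) (by exact_mod_cast hΩ)
    have h₃ : (0 : ℝ) ≤ (D : ℝ) ^ 2 * s := by positivity
    have h₄ : (0 : ℝ) ≤ (E.prog.length : ℝ) := by positivity
    linarith
  refine ⟨hV', hcost, minpoly (RatField k t) ν, fun j => finPoly d (T j), ?_, ?_, ?_, ?_⟩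
  · refine (isGeomResProjOutput_iff hδ).2 ⟨a, T, hinj ?_, fun j => hinj ?_, hqa, fun j => rfl⟩
    · rw [hmulVec, hpow, ha]
    · rw [hmulVec, hwT]
  · intro qmu' v' h
    obtain ⟨a', b', h₁, h₂, rfl, h₄⟩ := (isGeomResProjOutput_iff hδ).1 h
    -- Uniqueness: the powers of `μ` below its degree are linearly independent.
    have ha' : a' = a := hμinj <| by rw [← hmulVec, h₁, hpow, ha]
    refine ⟨by rw [ha', ← hqa], funext fun j => ?_⟩
    have hb' : b' j = T j := hμinj <| by rw [← hmulVec, h₂, hwT]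
    rw [h₄, hb']
  · refine ⟨hmu, rfl, fun j => ?_, fun j => ?_⟩
    · rw [hνdeg]; exact degree_finPoly_lt _
    · rw [← hν, ← powComb_apply, hT]
  · have hscal : (Sum.elim (genScalars t c) (genScalars t mu) : Fin n ⊕ Fin s → RatField k t) =
        genScalars t (Sum.elim c mu) := by
      funext i; cases i <;> rfl
    have hadj : ∀ j, powComb D y (coeffVec D (w (Fin.castLE hsr j))) ∈
        Algebra.adjoin (RatField k t) {ι ν} := fun j => by
      rw [← hwT]; exact Polynomial.aeval_mem_adjoin_singleton _ _
    have hok := Comp.ok_geomResProj (m := genScalars t mu) (A := GenericRing k V) (μ := ι ν) hsr hl₀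
      (q' := coeffVec D q) (w' := fun j => coeffVec D (w j)) hqE hwE hD0 hinj
      (by rw [pow_add_powComb_coeffVec hqm hqD, hy0])
      (by simp only [hwj, hν, cls_linForm, map_sum, map_smul, hι, genericRingMap_cls_X])
      hμint (by rw [hmin, ← hd]; exact hdD) hadj
    rw [hscal] at hok
    obtain ⟨l, P, ⟨res, g⟩, hrun, hP, hlen, ⟨hdeg, hqc, hvc⟩, hg⟩ := run_geomResProjTree hok
    rw [hmin, ← hd] at hdeg
    rw [hmin, ← hd] at hqc
    rw [hmin, ← hd] at hvc
    -- The run analysed so far is generic; for `x` with `H(x) ≠ 0` the tree reaches this very leaf,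
    -- so all facts about its program remain available.
    obtain ⟨H, hH, hspec⟩ := CompTree.run_specialize hrun
    refine ⟨H, hH, fun x hx => ?_⟩
    obtain ⟨lx, hlx⟩ := hspec x hx [] .nil
    let b : Fin (n + s) → k := fun i => Sum.elim c mu (finSumFinEquiv.symm i)
    have hb : (fun i => genScalars t b (finSumFinEquiv i)) = genScalars t (Sum.elim c mu) := by
      funext i; simp [genScalars, b]
    have hPb : SLP.runGeneric b (P.map finSumFinEquiv) = some l := by
      rw [SLP.runGeneric, SLP.run_map]
      exact (congrArg (fun z => SLP.run z (genPoint k t) P []) hb).trans hP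
    have hval : ∀ {o : Operand (Fin n ⊕ Fin s) t} {f : RatField k t},
        o.eval (genScalars t (Sum.elim c mu)) (genPoint k t) l = some f →
        (o.map finSumFinEquiv).HasValue b l f := fun {o f} ho => by
      rw [Operand.HasValue, Operand.eval_map]
      exact (congrArg (fun z => o.eval z (genPoint k t) l) hb).trans ho
    have hidx : ∀ N < d, ((Fin.ofNat (D + 1) N : Fin (D + 1)) : ℕ) = N := fun N hN => by
      rw [Fin.val_ofNat, Nat.mod_eq_of_lt (by omega)]
    have hq' : ∀ N < d, (res.q (Fin.ofNat (D + 1) N)).eval (genScalars t (Sum.elim c mu))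
        (genPoint k t) l = some ((minpoly (RatField k t) ν).coeff N) := fun N hN => by
      have := hqc (Fin.ofNat (D + 1) N) ((hidx N hN).trans_lt hN)
      rwa [hidx N hN] at this
    have hv' : ∀ j, ∀ N < d, (res.v j (Fin.ofNat (D + 1) N)).eval
        (genScalars t (Sum.elim c mu)) (genPoint k t) l =
          some ((finPoly d (T j)).coeff N) := fun j N hN => by
      obtain ⟨U, hU, hUj, hU0⟩ := hvc j
      -- The vector found by elimination has length `D + 1` with zeros from index `d` on. Both
      -- polynomials have degree below that of the minimal polynomial and the same value at `ι ν`.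
      have hfin' : finPoly (D + 1) U = finPoly d (T j) := by
        refine eq_of_aeval_eq_of_degree_lt (y := ι ν) ?_ ?_ ?_
        · rw [hmin, hνdeg, Polynomial.degree_lt_iff_coeff_zero]
          intro M hM
          by_cases hMD : M < D + 1
          · rw [coeff_finPoly _ hMD]; exact hU0 _ hM
          · exact coeff_finPoly_eq_zero _ (not_lt.1 hMD)
        · rw [hmin, hνdeg]; exact degree_finPoly_lt _
        · rw [← powComb_apply, ← powComb_apply, hUj, hwT]
      rw [← hfin', coeff_finPoly _ (by omega : N < D + 1)]
      have := hU (Fin.ofNat (D + 1) N)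
      rwa [show (Fin.ofNat (D + 1) N : Fin (D + 1)) = ⟨N, by omega⟩ from
        Fin.ext (hidx N hN)] at this ⊢
    refine ⟨lx, .ofPath P res g, b, hlx, fun i => rfl, hdeg.trans hδ.symm, ?_, ?_, ?_⟩
    · refine ⟨hνm, hd.symm.trans hdeg.symm, fun j => ?_, l, hPb,
        fun i => hval (hq' i (i.2.trans_eq hdeg)), fun j i => hval (hv' j i (i.2.trans_eq hdeg))⟩
      change _ < ((res.deg : ℕ) : WithBot ℕ)
      rw [hdeg]
      exact degree_finPoly_lt _
    · refine ⟨l, hPb, fun i h => hval ?_⟩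
      obtain ⟨u, hu, huν⟩ := hg i
      -- The computed vector and that of `p_{μ^i}` have the same image `μ^i`, hence coincide.
      rw [hu h, hinj (huν.trans (hpow i).symm)]
      rfl
    · refine le_trans ?_ hcost
      have : (P.map finSumFinEquiv).length = P.length := SLP.length_map _ _
      exact_mod_cast this.trans_le hlen

end
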